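/- **Theorem 4.1.** For each $m\ge 0$ let $U_1,\dots,U_m$ be independent random variables uniformly distributed on $[0,1)$, put $U_0=0$ and $U_{m+1}=1$, let $U_{0:m}\le U_{1:m}\le\dots\le U_{m+1:m}$ be the ordered values of $U_0,\dots,U_{m+1}$, and let $D_{j,m}=U_{j:m}-U_{j-1:m}$, $1\le j\le m+1$, be the uniform spacings. For real $t$ put $$P_m(t)=\mathbb P\Bigl(\max_{1\le j\le m+1}\{D_{j,m}-U_{j-1:m}\}\le t\Bigr).$$ Let $X_1,X_2,\dots$ be independent exponential random variables with mean $1$. Then the series $J=\sum_{j=1}^\infty\frac{1}{2^j-1}X_j$ converges almost surely and, as $m\to\infty$, $$(m+1)\sum_{j=1}^{m+1}\frac{1}{2^j-1}D_{j,m}\xrightarrow{d}J .$$ The distribution function $P(t)=\mathbb P(J\le t)$ of the limit satisfies, for every real $t$, $$P(t)=\lim_{m\to\infty}\mathbb P\Bigl((m+1)\sum_{j=1}^{m+1}\frac{1}{2^j-1}D_{j,m}\le t\Bigr)=\lim_{m\to\infty}P_m\bigl(t/(m+1)\bigr),$$ and, for every $t\ge 0$, $$P(t)=1-\sum_{j=1}^{\infty}(-1)^{j-1}2^j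 e^{-(2^j-1)t}\prod_{l=1}^{j}\frac{1}{2^l-1},$$ where the series converges absolutely. Moreover $P$ satisfies the integral equation $$e^{-t}P(t)=\int_t^{2t}e^{-u}P(u)\,du\qquad(t\in\mathbb R).$$ -/

import Mathlib

open MeasureTheory ProbabilityTheory Filter Topology

noncomputable section

namespace UniformSpacings

/-- The points `U_0 = 0, U_1, …, U_n, U_{n+1} = 1`, where `u i` is `U_{i+1}`. -/
def points {n : ℕ} (u : Fin n → ℝ) : Fin (n + 2) → ℝ :=
  Fin.cons (α := fun _ => ℝ) 0 (Fin.snoc (α := fun _ => ℝ) u 1)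

/-- `orderStat u i` is `U_{i:n}`, the `i`-th smallest (`0 ≤ i ≤ n+1`) of `U_0, …, U_{n+1}`. -/
def orderStat {n : ℕ} (u : Fin n → ℝ) : Fin (n + 2) → ℝ :=
  points u ∘ Tuple.sort (points u)

/-- The `n + 1` spacings: `spacing u i` is `D_{i+1,n} = U_{i+1:n} - U_{i:n}`, `0 ≤ i ≤ n`. -/
def spacing {n : ℕ} (u : Fin n → ℝ) (i : Fin (n + 1)) : ℝ :=
  orderStat u i.succ - orderStat u i.castSucc

/-- `coeff j` is `c_{j+1} = 1 / (2^{j+1} - 1)`, `j = 0, 1, 2, …`. -/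
def coeff (j : ℕ) : ℝ := 1 / ((2 : ℝ) ^ (j + 1) - 1)

/-- `∑_{j=1}^{m+1} (2^j - 1)⁻¹ D_{j,m}`. -/
def weightedSpacings {m : ℕ} (u : Fin m → ℝ) : ℝ :=
  ∑ i : Fin (m + 1), coeff i * spacing u i

/-- `max_{1 ≤ j ≤ m+1} (D_{j,m} - U_{j-1:m})`. -/
def maxGain {m : ℕ} (u : Fin m → ℝ) : ℝ :=
  Finset.univ.sup' Finset.univ_nonempty
    fun i : Fin (m + 1) => spacing u i - orderStat u i.castSucc

/-- `∑_{j=1}^∞ (2^j - 1)⁻¹ x_j`, where `x j` is `x_{j+1}`. -/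
def limitSum (x : ℕ → ℝ) : ℝ := ∑' j : ℕ, coeff j * x j

/-- The distribution function `t ↦ μ(Y ≤ t)` of a random variable `Y`. -/
def distFun {Ω : Type*} [MeasurableSpace Ω] (μ : Measure Ω) (Y : Ω → ℝ) (t : ℝ) : ℝ :=
  μ.real {ω | Y ω ≤ t}

end UniformSpacings

end

open UniformSpacings

/-! Let F_n (`hypoCdf n`) be the distribution function of the n-th partial sum of J. Convolution
with an exponential density of rate r_{n+1} = 2^{n+1} - 1 gives F_{n+1}' = r_{n+1} (F_n - F_{n+1}).
Because r_{n+1} = 2 r_n + 1, this derivative is also a multiple of e^{-t} F_n(2t)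
(`rate_mul_hypoCdf_sub`), and hence e^{-t} F_{n+1}(t) = ∫_t^{2t} e^{-u} F_n(u) du
(`exp_mul_hypoCdf_succ`). Conditioning the largest of the gains X_i - ∑_{j<i} X_j on the first
variable yields the same recursion, so for each n the weighted sum and the maximal gain of n
exponentials have the same law (`expPi_weightedSum_le`, `expPi_gains_le`).

Uniform order statistics are distributed as normalized partial sums of exponentials
(`hasLaw_orderStat`). In that representation both statistics, multiplied by m + 1, equal
(m+1)/S_{m+1} times a quantity that converges almost surely, and the factor tends to 1 by the law of
large numbers. The limits are J and the supremum of the gains, which agree in law by letting n → ∞.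

The integral equation survives the limit F_n → P. A bounded solution vanishing at infinity is zero
(`eq_zero_of_integral_equation`); the series solves the same equation and also tends to 1, so it
equals P on [0, ∞). -/

namespace UniformSpacings

/-! ### Distribution functions of the partial sums: differential and integral equations. -/

/-- The rate `2 ^ n - 1`. -/
noncomputable def rate (n : ℕ) : ℝ := 2 ^ n - 1

lemma rate_succ_pos (n : ℕ) : 0 < rate (n + 1) := by
  have : (1 : ℝ) < 2 ^ (n + 1) := one_lt_pow₀ (by norm_num) (by omega)
  unfold rate; linarith

lemma coeff_eq_inv_rate (n : ℕ) : coeff n = (rate (n + 1))⁻¹ := by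
  simp [coeff, rate]

lemma coeff_pos (n : ℕ) : 0 < coeff n := by
  rw [coeff_eq_inv_rate]; exact inv_pos.2 (rate_succ_pos n)

/-- The distribution function on `[0, ∞)` of `∑_{j < n} coeff j * X_j`, defined by successive
convolution with exponential densities. -/
noncomputable def hypoCdf : ℕ → ℝ → ℝ
  | 0 => fun _ => 1
  | n + 1 => fun t => Real.exp (-(rate (n + 1) * t)) *
      ∫ u in (0 : ℝ)..t, rate (n + 1) * Real.exp (rate (n + 1) * u) * hypoCdf n u

lemma hypoCdf_succ_zero (n : ℕ) : hypoCdf (n + 1) 0 = 0 := by simp [hypoCdf]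

/-- Continuity is a hypothesis here because it is itself proved by induction from this derivative.
-/
lemma hasDerivAt_hypoCdf_succ_of_continuous {n : ℕ} (h : Continuous (hypoCdf n)) (t : ℝ) :
    HasDerivAt (hypoCdf (n + 1)) (rate (n + 1) * (hypoCdf n t - hypoCdf (n + 1) t)) t := by
  have h1 : HasDerivAt (fun t : ℝ => Real.exp (-(rate (n + 1) * t)))
      (Real.exp (-(rate (n + 1) * t)) * -(rate (n + 1) * 1)) t :=
    ((hasDerivAt_id t).const_mul _).neg.exp
  have hc : Continuous fun u => rate (n + 1) * Real.exp (rate (n + 1) * u) * hypoCdf n u := by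
    fun_prop
  have h2 := intervalIntegral.integral_hasDerivAt_right (hc.intervalIntegrable 0 t)
    (hc.stronglyMeasurableAtFilter _ _) hc.continuousAt
  refine (h1.mul h2).congr_deriv ?_
  have : Real.exp (-(rate (n + 1) * t)) * Real.exp (rate (n + 1) * t) = 1 := by
    rw [← Real.exp_add]; simp
  simp only [hypoCdf]
  linear_combination rate (n + 1) * hypoCdf n t * this

lemma continuous_hypoCdf : ∀ n, Continuous (hypoCdf n)
  | 0 => continuous_const
  | n + 1 => continuous_iff_continuousAt.2 fun t =>
      (hasDerivAt_hypoCdf_succ_of_continuous (continuous_hypoCdf n) t).continuousAt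

lemma hasDerivAt_hypoCdf_succ (n : ℕ) (t : ℝ) :
    HasDerivAt (hypoCdf (n + 1)) (rate (n + 1) * (hypoCdf n t - hypoCdf (n + 1) t)) t :=
  hasDerivAt_hypoCdf_succ_of_continuous (continuous_hypoCdf n) t

/-- The integrating factor e^{rt} makes e^{rt} d(t) constant. -/
lemma eq_zero_of_hasDerivAt_neg_mul {d : ℝ → ℝ} {r : ℝ} (h0 : d 0 = 0)
    (h : ∀ t, HasDerivAt d (-r * d t) t) (t : ℝ) : d t = 0 := by
  have h1 : ∀ t, HasDerivAt (fun t => Real.exp (r * t) * d t) 0 t := fun t => by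
    have h2 : HasDerivAt (fun t : ℝ => Real.exp (r * t)) (Real.exp (r * t) * (r * 1)) t :=
      ((hasDerivAt_id t).const_mul _).exp
    refine (h2.mul (h t)).congr_deriv ?_
    ring
  have h3 := is_const_of_deriv_eq_zero (fun t => (h1 t).differentiableAt)
    (fun t => (h1 t).deriv) t 0
  simpa [h0, (Real.exp_pos _).ne'] using h3

/-- The delay identity for the derivative of `hypoCdf (n + 1)`. -/
lemma rate_mul_hypoCdf_sub (n : ℕ) (t : ℝ) :
    rate (n + 1) * (hypoCdf n t - hypoCdf (n + 1) t) =
      2 * (1 - (2 ^ (n + 1))⁻¹) * Real.exp (-t) * hypoCdf n (2 * t) := by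
  induction n generalizing t with
  | zero =>
    have key := eq_zero_of_hasDerivAt_neg_mul (r := 1)
      (d := fun t => 1 - hypoCdf 1 t - Real.exp (-t)) (by simp [hypoCdf_succ_zero]) (fun t => by
        have h1 := hasDerivAt_hypoCdf_succ 0 t
        have h2 : HasDerivAt (fun t : ℝ => Real.exp (-t)) (Real.exp (-t) * -1) t :=
          (hasDerivAt_id t).neg.exp
        refine ((h1.const_sub 1).sub h2).congr_deriv ?_
        simp [rate, hypoCdf]; ring) t
    have hr : rate (0 + 1) = 1 := by norm_num [rate]
    have h0 : ∀ s, hypoCdf 0 s = 1 := fun _ => rfl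
    have h1 : 2 * (1 - ((2 : ℝ) ^ (0 + 1))⁻¹) = 1 := by norm_num
    rw [hr, h0, h0, h1]
    linarith
  | succ n ih =>
    -- The difference d of the two sides satisfies d' = -r_{n+2} d: after the induction hypothesis
    -- at t, the terms in F_n(2t) cancel since r_{n+2} (1 - 2^{-(n+1)}) = 2 (1 - 2^{-(n+2)})
    -- r_{n+1}.
    have key := eq_zero_of_hasDerivAt_neg_mul (r := rate (n + 2))
      (d := fun t => rate (n + 2) * (hypoCdf (n + 1) t - hypoCdf (n + 2) t) -
        2 * (1 - (2 ^ (n + 2))⁻¹) * (Real.exp (-t) * hypoCdf (n + 1) (2 * t)))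
      (by simp [hypoCdf_succ_zero]) (fun t => by
        have h1 := hasDerivAt_hypoCdf_succ n t
        have h2 := hasDerivAt_hypoCdf_succ (n + 1) t
        have h3 : HasDerivAt (fun t : ℝ => Real.exp (-t)) (Real.exp (-t) * -1) t :=
          (hasDerivAt_id t).neg.exp
        have h4 := (hasDerivAt_hypoCdf_succ n (2 * t)).comp t ((hasDerivAt_id t).const_mul 2)
        refine (((h1.sub h2).const_mul _).sub ((h3.mul h4).const_mul _)).congr_deriv ?_
        rw [ih t]
        simp only [rate, Function.comp_def]
        have h5 : (2 : ℝ) ^ n ≠ 0 := by positivity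
        field_simp
        ring) t
    linarith

/-- The finite form of the integral equation. -/
lemma exp_mul_hypoCdf_succ (n : ℕ) (t : ℝ) :
    Real.exp (-t) * hypoCdf (n + 1) t = ∫ u in t..(2 * t), Real.exp (-u) * hypoCdf n u := by
  have hc : Continuous fun u => Real.exp (-u) * hypoCdf n u := by
    have := continuous_hypoCdf n
    fun_prop
  have hI : ∀ t, HasDerivAt (fun t => ∫ u in (0 : ℝ)..t, Real.exp (-u) * hypoCdf n u)
      (Real.exp (-t) * hypoCdf n t) t := fun t =>
    intervalIntegral.integral_hasDerivAt_right (hc.intervalIntegrable 0 t)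
      (hc.stronglyMeasurableAtFilter _ _) hc.continuousAt
  have hd : ∀ t, HasDerivAt (fun t => Real.exp (-t) * hypoCdf (n + 1) t -
      ((∫ u in (0 : ℝ)..(2 * t), Real.exp (-u) * hypoCdf n u) -
        ∫ u in (0 : ℝ)..t, Real.exp (-u) * hypoCdf n u)) 0 t := fun t => by
    have h3 : HasDerivAt (fun t : ℝ => Real.exp (-t)) (Real.exp (-t) * -1) t :=
      (hasDerivAt_id t).neg.exp
    have h4 := (hI (2 * t)).comp t ((hasDerivAt_id t).const_mul 2)
    refine ((h3.mul (hasDerivAt_hypoCdf_succ n t)).sub (h4.sub (hI t))).congr_deriv ?_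
    have h5 := rate_mul_hypoCdf_sub n t
    have h6 : Real.exp (-(2 * t)) = Real.exp (-t) * Real.exp (-t) := by
      rw [← Real.exp_add]; congr 1; ring
    -- The delay identity divided by r_{n+1} = 2^{n+1} (1 - 2^{-(n+1)}); it eliminates F_{n+1} from
    -- the derivative.
    have h7 : hypoCdf (n + 1) t = hypoCdf n t -
        2 * (2 ^ (n + 1))⁻¹ * Real.exp (-t) * hypoCdf n (2 * t) := by
      have h8 : (2 : ℝ) ^ (n + 1) ≠ 0 := by positivity
      apply mul_left_cancel₀ (rate_succ_pos n).ne'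
      have h9 : rate (n + 1) * (2 ^ (n + 1))⁻¹ = 1 - (2 ^ (n + 1))⁻¹ := by
        rw [rate]; field_simp
      linear_combination -h5 + 2 * Real.exp (-t) * hypoCdf n (2 * t) * h9
    rw [h5, h6, h7]
    ring
  have h0 := is_const_of_deriv_eq_zero (fun t => (hd t).differentiableAt)
    (fun t => (hd t).deriv) t 0
  have h1 := intervalIntegral.integral_interval_sub_left
    (hc.intervalIntegrable (μ := volume) 0 (2 * t))
    (hc.intervalIntegrable 0 t)
  simp only [hypoCdf_succ_zero, mul_zero, sub_self] at h0
  linarith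

/-! ### Laws of the weighted sum and of the maximal gain of n exponentials. -/

instance : IsProbabilityMeasure (expMeasure 1) := isProbabilityMeasure_expMeasure one_pos

lemma expMeasure_one_eq :
    expMeasure 1 = (volume.restrict (Set.Ioi 0)).withDensity fun x =>
      ENNReal.ofReal (Real.exp (-x)) := by
  have h : expMeasure 1 = volume.withDensity (exponentialPDF 1) := rfl
  rw [h, ← withDensity_indicator measurableSet_Ioi]
  refine withDensity_congr_ae ?_
  have h0 : ∀ᵐ x : ℝ, x ≠ 0 := by simp [ae_iff]
  filter_upwards [h0] with x hx
  rw [exponentialPDF_eq]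
  by_cases h : 0 < x
  · simp [h, h.le]
  · have : ¬ 0 ≤ x := fun h' => h (lt_of_le_of_ne h' hx.symm)
    simp [h, this]

lemma lintegral_expMeasure_one {f : ℝ → ENNReal} (hf : Measurable f) :
    ∫⁻ x, f x ∂expMeasure 1 = ∫⁻ x in Set.Ioi 0, ENNReal.ofReal (Real.exp (-x)) * f x := by
  rw [expMeasure_one_eq, lintegral_withDensity_eq_lintegral_mul _ (by fun_prop) hf]
  rfl

lemma ae_pos_expMeasure_one : ∀ᵐ x ∂expMeasure 1, 0 < x := by
  rw [expMeasure_one_eq]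
  exact (withDensity_absolutelyContinuous _ _).ae_le (ae_restrict_mem measurableSet_Ioi)

/-- The joint law of `n` independent standard exponential random variables. -/
noncomputable abbrev expPi (n : ℕ) : Measure (Fin n → ℝ) := Measure.pi fun _ => expMeasure 1

lemma ae_pos_expPi (n : ℕ) : ∀ᵐ x ∂expPi n, ∀ i, 0 < x i := by
  rw [ae_all_iff]
  intro i
  exact (measurePreserving_eval (fun _ : Fin n => expMeasure 1) i).quasiMeasurePreserving.ae
    ae_pos_expMeasure_one

/-- Tonelli with a free choice of coordinate: the weighted sum splits off the last variable, the
maximal gain the first. -/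
lemma expPi_succ_insertNth {n : ℕ} (i : Fin (n + 1)) {S : Set (Fin (n + 1) → ℝ)}
    (hS : MeasurableSet S) :
    expPi (n + 1) S =
      ∫⁻ y, expPi n {x | (i.insertNth y x : Fin (n + 1) → ℝ) ∈ S} ∂expMeasure 1 := by
  have h := (measurePreserving_piFinSuccAbove (fun _ : Fin (n + 1) => expMeasure 1) i).symm
  rw [← h.measure_preimage_equiv, Measure.prod_apply
    ((MeasurableEquiv.piFinSuccAbove (fun _ => ℝ) i).symm.measurable hS)]
  rfl

lemma hypoCdf_nonneg (n : ℕ) {t : ℝ} (ht : 0 ≤ t) : 0 ≤ hypoCdf n t := by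
  induction n generalizing t with
  | zero => simp [hypoCdf]
  | succ n ih =>
    have h := rate_succ_pos n
    refine mul_nonneg (Real.exp_pos _).le (intervalIntegral.integral_nonneg ht fun u hu => ?_)
    have := ih hu.1
    positivity

/-- Nonnegativity is asked only on (0, a], since `hypoCdf` is a distribution function only on [0,
∞). -/
lemma lintegral_Ioi_indicator_Ioc {f : ℝ → ℝ} (hf : Continuous f) {a : ℝ} (ha : 0 ≤ a)
    (h0 : ∀ x ∈ Set.Ioc 0 a, 0 ≤ f x) :
    ∫⁻ x in Set.Ioi 0, (if x ≤ a then ENNReal.ofReal (f x) else 0) =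
      ENNReal.ofReal (∫ x in (0 : ℝ)..a, f x) := by
  rw [intervalIntegral.integral_of_le ha, ofReal_integral_eq_lintegral_ofReal
    (hf.integrableOn_Icc.mono_set Set.Ioc_subset_Icc_self)
    ((ae_restrict_iff' measurableSet_Ioc).2 (ae_of_all _ h0)), ← Set.Ioi_inter_Iic,
    ← Set.inter_comm, ← setLIntegral_indicator measurableSet_Iic]
  rfl

lemma expPi_weightedSum_le_of_neg (n : ℕ) {t : ℝ} (ht : t < 0) :
    expPi n {x | ∑ i : Fin _, coeff i * x i ≤ t} = 0 := by
  have h : ∀ᵐ x ∂expPi n, ¬ ∑ i : Fin _, coeff i * x i ≤ t := by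
    filter_upwards [ae_pos_expPi n] with x hx
    exact not_le.2 (ht.trans_le (Finset.sum_nonneg fun i _ => (mul_pos (coeff_pos i) (hx i)).le))
  simpa [ae_iff] using h

lemma measurableSet_weightedSum_le (n : ℕ) (t : ℝ) :
    MeasurableSet {x : Fin n → ℝ | ∑ i : Fin _, coeff i * x i ≤ t} :=
  measurableSet_le (by fun_prop) measurable_const

/-- `hypoCdf n` is the distribution function of `∑_{j < n} coeff j * X_j`. -/
lemma expPi_weightedSum_le (n : ℕ) {t : ℝ} (ht : 0 ≤ t) :
    expPi n {x | ∑ i : Fin _, coeff i * x i ≤ t} = ENNReal.ofReal (hypoCdf n t) := by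
  induction n generalizing t with
  | zero => simp [hypoCdf, ht]
  | succ n ih =>
    have hr := rate_succ_pos n
    have hc := coeff_eq_inv_rate n
    have hcont := continuous_hypoCdf n
    have hsec : ∀ y, expPi n {x | ((Fin.last n).insertNth y x : Fin (n + 1) → ℝ) ∈
        {x : Fin (n + 1) → ℝ | ∑ i : Fin _, coeff i * x i ≤ t}} =
        if y ≤ rate (n + 1) * t then ENNReal.ofReal (hypoCdf n (t - coeff n * y)) else 0 := by
      intro y
      have : {x | ((Fin.last n).insertNth y x : Fin (n + 1) → ℝ) ∈
          {x : Fin (n + 1) → ℝ | ∑ i : Fin _, coeff i * x i ≤ t}} =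
          {x : Fin n → ℝ | ∑ i : Fin _, coeff i * x i ≤ t - coeff n * y} := by
        ext x
        simp [Fin.sum_univ_castSucc, le_sub_iff_add_le]
      rw [this]
      have hiff : y ≤ rate (n + 1) * t ↔ 0 ≤ t - coeff n * y := by
        rw [hc, sub_nonneg, inv_mul_le_iff₀ hr]
      split_ifs with h
      · exact ih (hiff.1 h)
      · exact expPi_weightedSum_le_of_neg n (not_le.1 fun h' => h (hiff.2 h'))
    rw [expPi_succ_insertNth (Fin.last n) (measurableSet_weightedSum_le _ _)]
    simp_rw [hsec]
    rw [lintegral_expMeasure_one (Measurable.ite measurableSet_Iic (by fun_prop) (by fun_prop))]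
    have h1 : ∀ y : ℝ, (ENNReal.ofReal (Real.exp (-y)) * if y ≤ rate (n + 1) * t then
        ENNReal.ofReal (hypoCdf n (t - coeff n * y)) else 0) = if y ≤ rate (n + 1) * t then
        ENNReal.ofReal (Real.exp (-y) * hypoCdf n (t - coeff n * y)) else 0 := fun y => by
      rw [ENNReal.ofReal_mul (Real.exp_pos _).le]; split_ifs <;> simp
    simp_rw [h1]
    rw [lintegral_Ioi_indicator_Ioc (by fun_prop) (by positivity)]
    · congr 1
      -- The substitution u = t - c y, with c = 1/r_{n+1}, recovers the defining integral of
      -- `hypoCdf`.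
      have h2 := intervalIntegral.smul_integral_comp_sub_mul
        (fun u => rate (n + 1) * Real.exp (-(rate (n + 1) * (t - u))) * hypoCdf n u)
        (a := 0) (b := rate (n + 1) * t) (coeff n) t
      have h3 : t - coeff n * (rate (n + 1) * t) = 0 := by rw [hc]; field_simp; ring
      rw [h3, mul_zero, sub_zero, smul_eq_mul, ← intervalIntegral.integral_const_mul] at h2
      simp only [hypoCdf]
      rw [← intervalIntegral.integral_const_mul]
      convert h2 using 1
      · refine intervalIntegral.integral_congr fun x _ => ?_
        have h4 : rate (n + 1) * (t - (t - coeff n * x)) = x := by rw [hc]; field_simp; ring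
        have h5 : coeff n * rate (n + 1) = 1 := by rw [hc]; field_simp
        simp only [h4]
        linear_combination (-Real.exp (-x) * hypoCdf n (t - coeff n * x)) * h5
      · refine intervalIntegral.integral_congr fun x _ => ?_
        have : Real.exp (-(rate (n + 1) * (t - x))) =
            Real.exp (-(rate (n + 1) * t)) * Real.exp (rate (n + 1) * x) := by
          rw [← Real.exp_add]; congr 1; ring
        simp only [this]
        ring
    · intro y hy
      refine mul_nonneg (Real.exp_pos _).le (hypoCdf_nonneg n ?_)
      rw [hc, sub_nonneg, inv_mul_le_iff₀ hr]
      exact hy.2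

lemma measurableSet_gains_le (n : ℕ) (t : ℝ) :
    MeasurableSet {x : Fin n → ℝ | ∀ i, x i - ∑ j with j < i, x j ≤ t} := by
  rw [Set.ofPred_forall]
  exact MeasurableSet.iInter fun i => measurableSet_le (by fun_prop) measurable_const

/-- `hypoCdf n` is also the distribution function of `max_{i < n} (X_i - ∑_{j < i} X_j)`. -/
lemma expPi_gains_le (n : ℕ) {t : ℝ} (ht : 0 ≤ t) :
    expPi n {x | ∀ i, x i - ∑ j with j < i, x j ≤ t} = ENNReal.ofReal (hypoCdf n t) := by
  induction n generalizing t with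
  | zero => simp [hypoCdf]
  | succ n ih =>
    have hcont := continuous_hypoCdf n
    -- If the first variable is y, its own gain is y and every later gain drops by y, so the
    -- remaining variables face the threshold t + y.
    have hsec : ∀ y, expPi n {x | ((0 : Fin (n + 1)).insertNth y x : Fin (n + 1) → ℝ) ∈
        {x : Fin (n + 1) → ℝ | ∀ i, x i - ∑ j with j < i, x j ≤ t}} =
        if y ≤ t then expPi n {x | ∀ i, x i - ∑ j with j < i, x j ≤ t + y} else 0 := by
      intro y
      have : {x | ((0 : Fin (n + 1)).insertNth y x : Fin (n + 1) → ℝ) ∈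
          {x : Fin (n + 1) → ℝ | ∀ i, x i - ∑ j with j < i, x j ≤ t}} =
          {x : Fin n → ℝ | y ≤ t ∧ ∀ i, x i - ∑ j with j < i, x j ≤ t + y} := by
        ext x
        simp [Fin.forall_fin_succ, Finset.sum_filter, Fin.sum_univ_succ,
          add_assoc]
      rw [this]
      split_ifs with h <;> simp [h]
    rw [expPi_succ_insertNth 0 (measurableSet_gains_le _ _)]
    simp_rw [hsec]
    have h1 : ∀ᵐ y ∂expMeasure 1, (if y ≤ t then
        expPi n {x | ∀ i, x i - ∑ j with j < i, x j ≤ t + y} else 0) =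
        if y ≤ t then ENNReal.ofReal (hypoCdf n (t + y)) else 0 := by
      filter_upwards [ae_pos_expMeasure_one] with y hy
      rw [ih (by positivity)]
    rw [lintegral_congr_ae h1,
      lintegral_expMeasure_one (Measurable.ite measurableSet_Iic (by fun_prop) (by fun_prop))]
    have h1 : ∀ y : ℝ, (ENNReal.ofReal (Real.exp (-y)) * if y ≤ t then
        ENNReal.ofReal (hypoCdf n (t + y)) else 0) = if y ≤ t then
        ENNReal.ofReal (Real.exp (-y) * hypoCdf n (t + y)) else 0 := fun y => by
      rw [ENNReal.ofReal_mul (Real.exp_pos _).le]; split_ifs <;> simp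
    simp_rw [h1]
    rw [lintegral_Ioi_indicator_Ioc (by fun_prop) ht]
    · congr 1
      -- With u = t + y the integral over [0, t] becomes the one over [t, 2t] in the finite integral
      -- equation, up to the factor e^{-t}.
      have h2 := exp_mul_hypoCdf_succ n t
      have h3 := intervalIntegral.integral_comp_add_left (a := 0) (b := t)
        (fun u => Real.exp (-u) * hypoCdf n u) t
      rw [add_zero, ← two_mul, ← h2] at h3
      have h4 : ∀ x, Real.exp (-(t + x)) = Real.exp (-t) * Real.exp (-x) := fun x => by
        rw [← Real.exp_add]; congr 1; ring
      simp_rw [h4, mul_assoc] at h3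
      rw [intervalIntegral.integral_const_mul] at h3
      exact mul_left_cancel₀ (Real.exp_pos _).ne' h3
    · intro y hy
      exact mul_nonneg (Real.exp_pos _).le (hypoCdf_nonneg n (by linarith [hy.1]))

/-! ### Order statistics of uniform variables and the open simplex. -/

section

variable {n : ℕ}

@[simp] lemma points_zero (u : Fin n → ℝ) : points u 0 = 0 := rfl

@[simp] lemma points_succ_castSucc (u : Fin n → ℝ) (i : Fin n) :
    points u i.castSucc.succ = u i := by
  simp only [points, Fin.cons_succ, Fin.snoc_castSucc]

@[simp] lemma points_succ_last (u : Fin n → ℝ) : points u (Fin.last n).succ = 1 := by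
  simp only [points, Fin.cons_succ, Fin.snoc_last]

@[simp] lemma points_last (u : Fin n → ℝ) : points u (Fin.last (n + 1)) = 1 := by
  rw [← Fin.succ_last, points_succ_last]

lemma forall_fin_add_two {p : Fin (n + 2) → Prop} :
    (∀ i, p i) ↔ p 0 ∧ (∀ i : Fin n, p i.castSucc.succ) ∧ p (Fin.last n).succ := by
  rw [Fin.forall_fin_succ, Fin.forall_fin_succ']

lemma measurable_points : Measurable (points : (Fin n → ℝ) → Fin (n + 2) → ℝ) := by
  refine measurable_pi_iff.2 (forall_fin_add_two.2 ⟨?_, fun i => ?_, ?_⟩)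
  · simp only [points_zero, measurable_const]
  · simp only [points_succ_castSucc]; fun_prop
  · simp only [points_succ_last, measurable_const]

/-- σ extends to a permutation of all n + 2 points fixing the endpoints 0 and 1, and sorting forgets
permutations. -/
lemma orderStat_comp_perm (u : Fin n → ℝ) (σ : Equiv.Perm (Fin n)) :
    orderStat (u ∘ σ) = orderStat u := by
  obtain ⟨τ, hτ, hτ'⟩ : ∃ τ : Equiv.Perm (Fin (n + 1)),
      (∀ i : Fin n, τ i.castSucc = (σ i).castSucc) ∧ τ (Fin.last n) = Fin.last n :=
    ⟨finSuccEquivLast.trans ((Equiv.optionCongr σ).trans finSuccEquivLast.symm), by simp, by simp⟩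
  obtain ⟨ρ, hρ, hρ'⟩ : ∃ ρ : Equiv.Perm (Fin (n + 2)),
      (∀ i : Fin (n + 1), ρ i.succ = (τ i).succ) ∧ ρ 0 = 0 :=
    ⟨(finSuccEquiv (n + 1)).trans ((Equiv.optionCongr τ).trans (finSuccEquiv (n + 1)).symm),
      by simp, by simp⟩
  have h : points (u ∘ σ) = points u ∘ ρ := by
    refine funext (forall_fin_add_two.2 ⟨?_, fun i => ?_, ?_⟩)
    · simp [hρ']
    · simp [hρ, hτ]
    · simp only [Function.comp_apply, hρ, hτ', points_succ_last]
  rw [orderStat, h]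
  exact Tuple.comp_perm_comp_sort_eq_comp_sort

/-- The i-th order statistic (from 0) is at most a exactly when more than i points are; this count
is measurable without reference to the sorting permutation. -/
lemma measurable_orderStat : Measurable (orderStat : (Fin n → ℝ) → Fin (n + 2) → ℝ) := by
  refine measurable_pi_iff.2 fun i => measurable_of_Iic fun a => ?_
  have h : (fun u : Fin n → ℝ => orderStat u i) ⁻¹' Set.Iic a =
      {u | (i : ℝ) < ∑ j, if points u j ≤ a then (1 : ℝ) else 0} := by
    ext u
    have h1 := Tuple.lt_card_le_iff_apply_le_of_monotone (a := a) (j := i)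
      (Tuple.monotone_sort (points u))
    have h2 : (Finset.univ.filter fun j => points u (Tuple.sort (points u) j) ≤ a).card =
        (Finset.univ.filter fun j => points u j ≤ a).card :=
      Finset.card_equiv (Tuple.sort (points u)) (by simp)
    simp only [Function.comp_apply, h2] at h1
    simp only [Set.mem_preimage, Set.mem_Iic, orderStat, Function.comp_apply, ← h1,
      Set.mem_ofPred_eq, Finset.sum_boole, Nat.cast_lt]
  rw [h]
  refine measurableSet_lt measurable_const (Finset.measurable_sum _ fun j _ => ?_)
  exact Measurable.ite (measurableSet_le ((measurable_pi_apply j).comp measurable_points)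
    measurable_const) measurable_const measurable_const

/-- The open simplex `0 < u_1 < ⋯ < u_n < 1`. -/
def openSimplex (n : ℕ) : Set (Fin n → ℝ) := {u | StrictMono u ∧ ∀ i, u i ∈ Set.Ioo 0 1}

lemma measurableSet_strictMono : MeasurableSet {u : Fin n → ℝ | StrictMono u} := by
  have : {u : Fin n → ℝ | StrictMono u} = ⋂ (i) (j) (_ : i < j), {u : Fin n → ℝ | u i < u j} := by
    ext u; simp [StrictMono]
  rw [this]
  exact MeasurableSet.iInter fun i => MeasurableSet.iInter fun j => MeasurableSet.iInter fun _ =>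
    measurableSet_lt (measurable_pi_apply i) (measurable_pi_apply j)

lemma measurableSet_openSimplex (n : ℕ) : MeasurableSet (openSimplex n) := by
  have h : MeasurableSet {u : Fin n → ℝ | ∀ i, u i ∈ Set.Ioo 0 1} := by
    rw [Set.ofPred_forall]
    exact MeasurableSet.iInter fun i => measurable_pi_apply i measurableSet_Ioo
  exact measurableSet_strictMono.inter h

lemma monotone_points {u : Fin n → ℝ} (hu : u ∈ openSimplex n) : Monotone (points u) := by
  have h0 := fun i => (hu.2 i).1.le
  have h1 := fun i => (hu.2 i).2.le
  suffices ∀ i j, i ≤ j → points u i ≤ points u j from fun i j => this i j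
  refine forall_fin_add_two.2 ⟨?_, fun i => ?_, ?_⟩ <;>
  refine forall_fin_add_two.2 ⟨?_, fun j => ?_, ?_⟩ <;>
  simp [h0, h1, hu.1.le_iff_le]

lemma orderStat_eq_points {u : Fin n → ℝ} (hu : u ∈ openSimplex n) : orderStat u = points u := by
  rw [orderStat, Tuple.sort_eq_refl_iff_monotone.2 (monotone_points hu)]
  rfl

/-- Each set u_i = u_j with i ≠ j is a proper linear subspace, hence null. -/
lemma ae_injective_volume : ∀ᵐ u : Fin n → ℝ, Function.Injective u := by
  have h : ∀ i j : Fin n, i ≠ j → ∀ᵐ u : Fin n → ℝ, u i ≠ u j := fun i j hij => by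
    have h1 := Measure.addHaar_submodule (volume : Measure (Fin n → ℝ))
      (LinearMap.ker ((LinearMap.proj i : (Fin n → ℝ) →ₗ[ℝ] ℝ) - LinearMap.proj j)) (fun htop => by
        have : Pi.single i (1 : ℝ) ∈
            LinearMap.ker ((LinearMap.proj i : (Fin n → ℝ) →ₗ[ℝ] ℝ) - LinearMap.proj j) :=
          htop ▸ Submodule.mem_top
        simp [LinearMap.mem_ker, hij.symm] at this)
    rw [ae_iff]
    convert h1 using 2
    ext u
    simp [sub_eq_zero]
  have h2 : ∀ᵐ u : Fin n → ℝ, ∀ i j : Fin n, i ≠ j → u i ≠ u j :=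
    ae_all_iff.2 fun i => ae_all_iff.2 fun j => ae_all_iff.2 fun hij => h i j hij
  filter_upwards [h2] with u hu i j hij
  by_contra hne
  exact hu i j hne hij

lemma ae_forall_ne_volume (a : ℝ) : ∀ᵐ u : Fin n → ℝ, ∀ i, u i ≠ a := by
  refine ae_all_iff.2 fun i => ?_
  exact (Measure.quasiMeasurePreserving_eval (fun _ : Fin n => (volume : Measure ℝ)) i).ae
    (p := fun x => x ≠ a) (by simp [ae_iff])

lemma volume_comp_perm_mem (σ : Equiv.Perm (Fin n)) (C : Set (Fin n → ℝ)) :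
    volume {u : Fin n → ℝ | u ∘ σ ∈ C} = volume C := by
  have h := volume_measurePreserving_piCongrLeft (fun _ : Fin n => ℝ) σ.symm
  rw [← h.measure_preimage_equiv C]
  congr 1
  ext u
  have : MeasurableEquiv.piCongrLeft (fun _ : Fin n => ℝ) σ.symm u = u ∘ σ := by
    ext i
    have := MeasurableEquiv.piCongrLeft_apply_apply (β := fun _ : Fin n => ℝ) σ.symm u (σ i)
    simpa using this
  simp [this]

/-- The law of the order statistics of `n` uniform variables is a multiple of Lebesgue measure on
the open simplex. -/
lemma volume_restrict_orderStat_mem {B : Set (Fin (n + 2) → ℝ)} (hB : MeasurableSet B) :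
    (volume.restrict (Set.univ.pi fun _ : Fin n => Set.Ico (0 : ℝ) 1)) (orderStat ⁻¹' B) =
      n.factorial * volume (openSimplex n ∩ points ⁻¹' B) := by
  have hC : MeasurableSet (openSimplex n ∩ points ⁻¹' B) :=
    (measurableSet_openSimplex n).inter (measurable_points hB)
  have hm : ∀ σ : Equiv.Perm (Fin n), Measurable fun u : Fin n → ℝ => u ∘ σ := fun σ =>
    measurable_pi_lambda _ fun i => measurable_pi_apply _
  -- Up to null sets the cube is the disjoint union of the n! coordinate permutations of the
  -- simplex.
  have hae : (orderStat ⁻¹' B ∩ (Set.univ.pi fun _ : Fin n => Set.Ico (0 : ℝ) 1) : Set _)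
      =ᵐ[volume] ⋃ σ : Equiv.Perm (Fin n), {u | u ∘ σ ∈ openSimplex n ∩ points ⁻¹' B} := by
    filter_upwards [ae_injective_volume, ae_forall_ne_volume 0] with u hinj hne
    refine propext ⟨fun hu => ?_, fun hu => ?_⟩
    · obtain ⟨huB, hu⟩ := hu
      have hmem : u ∘ Tuple.sort u ∈ openSimplex n :=
        ⟨(Tuple.monotone_sort u).strictMono_of_injective
          (hinj.comp (Tuple.sort u).injective), fun i =>
          ⟨lt_of_le_of_ne (hu _ trivial).1 (hne _).symm, (hu _ trivial).2⟩⟩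
      refine Set.mem_iUnion.2 ⟨Tuple.sort u, hmem, ?_⟩
      rw [Set.mem_preimage, ← orderStat_eq_points hmem, orderStat_comp_perm]
      exact huB
    · obtain ⟨σ, hσ, hσB⟩ := Set.mem_iUnion.1 hu
      refine ⟨?_, fun i _ => ?_⟩
      · rw [Set.mem_preimage, ← orderStat_comp_perm u σ, orderStat_eq_points hσ]
        exact hσB
      · have := hσ.2 (σ.symm i)
        simp only [Function.comp_apply, Equiv.apply_symm_apply] at this
        exact ⟨this.1.le, this.2⟩
  rw [Measure.restrict_apply (measurable_orderStat hB), measure_congr hae, measure_iUnion]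
  · simp_rw [volume_comp_perm_mem, tsum_fintype, Finset.sum_const, Finset.card_univ,
      Fintype.card_perm, Fintype.card_fin, nsmul_eq_mul]
  · intro σ τ hne
    refine Set.disjoint_left.2 fun u hσ hτ => hne ?_
    have h1 := Tuple.unique_monotone hσ.1.1.monotone hτ.1.1.monotone
    have h2 : Function.Injective u := by
      have := hσ.1.1.injective
      exact (Function.Injective.of_comp_iff' u σ.bijective).1 this
    ext i : 1
    exact h2 (congrFun h1 i)
  · exact fun σ => hm σ hC

end

/-! ### Normalized partial sums of exponential variables. -/

section

variable {n : ℕ}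

lemma lintegral_pi_prod {α : Type*} [MeasurableSpace α] :
    ∀ (n : ℕ) (μ : Fin n → Measure α) [∀ i, SigmaFinite (μ i)] {f : α → ENNReal}
      (_ : Measurable f), ∫⁻ x, ∏ i, f (x i) ∂Measure.pi μ = ∏ i, ∫⁻ x, f x ∂μ i
  | 0, μ, _, f, hf => by simp
  | n + 1, μ, _, f, hf => by
    have h := (measurePreserving_piFinSuccAbove μ 0).symm
    have hm : Measurable fun x : Fin n → α => ∏ i, f (x i) := by fun_prop
    rw [h.lintegral_map_equiv, Fin.prod_univ_succ, ← lintegral_pi_prod n _ hf,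
      ← lintegral_prod_mul hf.aemeasurable hm.aemeasurable]
    refine lintegral_congr fun x => ?_
    simp [Fin.prod_univ_succ]

lemma pi_withDensity {α : Type*} [MeasurableSpace α] (n : ℕ) (μ : Measure α) [SigmaFinite μ]
    {f : α → ENNReal} (hf : Measurable f) [SigmaFinite (μ.withDensity f)] :
    (Measure.pi fun _ : Fin n => μ.withDensity f) =
      (Measure.pi fun _ : Fin n => μ).withDensity fun x => ∏ i, f (x i) := by
  refine Measure.pi_eq fun s hs => ?_
  rw [withDensity_apply _ (MeasurableSet.univ_pi hs), Measure.restrict_pi_pi,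
    lintegral_pi_prod n _ hf]
  exact Finset.prod_congr rfl fun i _ => (withDensity_apply _ (hs i)).symm

/-- The joint density depends only on the total, which is why the normalized partial sums are
uniform on the simplex. -/
lemma expPi_eq_withDensity (n : ℕ) :
    expPi n = (volume.restrict {x : Fin n → ℝ | ∀ i, 0 < x i}).withDensity
      fun x => ENNReal.ofReal (Real.exp (-∑ i, x i)) := by
  have : SigmaFinite ((volume.restrict (Set.Ioi 0)).withDensity
      fun x => ENNReal.ofReal (Real.exp (-x))) := by
    rw [← expMeasure_one_eq]; infer_instance
  simp_rw [expPi, expMeasure_one_eq]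
  rw [pi_withDensity n _ (by fun_prop), ← Measure.restrict_pi_pi]
  have : (Set.univ.pi fun _ : Fin n => Set.Ioi (0 : ℝ)) = {x | ∀ i, 0 < x i} := by
    ext x; simp
  rw [this]
  congr 1
  ext x
  rw [← ENNReal.ofReal_prod_of_nonneg fun _ _ => (Real.exp_pos _).le, ← Real.exp_sum,
    Finset.sum_neg_distrib]

/-- The partial sums `x_0, x_0 + x_1, …`. -/
noncomputable def partialSums (x : Fin n → ℝ) (i : Fin n) : ℝ := ∑ j with j ≤ i, x j

lemma measurable_partialSums : Measurable (partialSums : (Fin n → ℝ) → Fin n → ℝ) :=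
  measurable_pi_lambda _ fun i => by unfold partialSums; fun_prop

/-- The matrix is lower triangular with unit diagonal, so its determinant is 1. -/
lemma measurePreserving_partialSums (n : ℕ) :
    MeasurePreserving (partialSums : (Fin n → ℝ) → Fin n → ℝ) volume volume := by
  refine ⟨measurable_partialSums, ?_⟩
  let M : Matrix (Fin n) (Fin n) ℝ := Matrix.of fun i j => if j ≤ i then 1 else 0
  have hdet : M.det = 1 := by
    rw [Matrix.det_of_isLowerTriangular M (fun i j hij => by
      have : i < j := hij
      simp [M, this])]
    simp [M]
  have h := Real.map_matrix_volume_pi_eq_smul_volume_pi (M := M) (by simp [hdet])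
  have h2 : ⇑(Matrix.toLin' M) = partialSums := by
    ext x i
    simp [M, partialSums, Matrix.mulVec, dotProduct, Finset.sum_filter]
  rw [h2, hdet] at h
  simpa using h

lemma partialSums_last (x : Fin (n + 1) → ℝ) : partialSums x (Fin.last n) = ∑ i, x i := by
  simp [partialSums, Fin.le_last]

lemma partialSums_zero (x : Fin (n + 1) → ℝ) : partialSums x 0 = x 0 := by
  simp [partialSums, Finset.sum_filter]

lemma partialSums_succ (x : Fin (n + 1) → ℝ) (i : Fin n) :
    partialSums x i.succ = partialSums x i.castSucc + x i.succ := by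
  have : (Finset.univ.filter fun j => j ≤ i.succ) =
      insert i.succ (Finset.univ.filter fun j => j ≤ i.castSucc) := by
    ext j
    simp [Fin.le_def, Fin.ext_iff]
    omega
  rw [partialSums, this, Finset.sum_insert (by simp [Fin.le_def]), add_comm]
  rfl

lemma forall_pos_iff_partialSums (x : Fin (n + 1) → ℝ) :
    (∀ i, 0 < x i) ↔ StrictMono (partialSums x) ∧ 0 < partialSums x 0 := by
  rw [Fin.forall_fin_succ, Fin.strictMono_iff_lt_succ, partialSums_zero, and_comm]
  simp [partialSums_succ]

/-- The partial sums `(x_0 + ⋯ + x_i) / (x_0 + ⋯ + x_n)`, `i < n`. -/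
noncomputable def normalizedSums (x : Fin (n + 1) → ℝ) : Fin n → ℝ :=
  fun i => partialSums x i.castSucc / partialSums x (Fin.last n)

lemma measurable_normalizedSums :
    Measurable (normalizedSums : (Fin (n + 1) → ℝ) → Fin n → ℝ) :=
  measurable_pi_lambda _ fun _ =>
    ((measurable_pi_apply _).comp measurable_partialSums).div
      ((measurable_pi_apply _).comp measurable_partialSums)

/-- In the cone of positive increasing vectors, the slice with last entry s is the simplex scaled by
s. -/
lemma inv_smul_mem_openSimplex_iff {w : Fin n → ℝ} {s : ℝ} (hs : 0 < s) :
    s⁻¹ • w ∈ openSimplex n ↔ StrictMono (Fin.snoc w s : Fin (n + 1) → ℝ) ∧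
      0 < (Fin.snoc w s : Fin (n + 1) → ℝ) 0 := by
  constructor
  · rintro ⟨h1, h2⟩
    have h3 : ∀ i, 0 < w i ∧ w i < s := fun i => by
      have := h2 i
      simp only [Pi.smul_apply, smul_eq_mul, Set.mem_Ioo, inv_mul_lt_iff₀ hs, mul_one] at this
      exact ⟨by simpa [hs] using this.1, this.2⟩
    constructor
    · suffices ∀ i j : Fin (n + 1), i < j →
          (Fin.snoc w s : Fin (n + 1) → ℝ) i < (Fin.snoc w s : Fin (n + 1) → ℝ) j from
        fun i j => this i j
      refine Fin.forall_fin_succ'.2 ⟨fun i => Fin.forall_fin_succ'.2 ⟨fun j hij => ?_, fun _ => ?_⟩,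
        fun j hj => absurd hj (Fin.le_last j).not_gt⟩
      · have := h1 (Fin.castSucc_lt_castSucc_iff.1 hij)
        simpa [hs] using this
      · simpa using (h3 i).2
    · refine (Fin.forall_fin_succ'.2 ⟨fun i => ?_, ?_⟩ :
        ∀ i : Fin (n + 1), 0 < (Fin.snoc w s : Fin (n + 1) → ℝ) i) 0
      · simpa using (h3 i).1
      · simpa using hs
  · rintro ⟨h1, h2⟩
    refine ⟨fun i j hij => ?_, fun i => ⟨?_, ?_⟩⟩
    · have := h1 (Fin.castSucc_lt_castSucc_iff.2 hij)
      simp only [Fin.snoc_castSucc] at this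
      simpa [hs] using this
    · have := h2.trans_le (h1.monotone (Fin.zero_le i.castSucc))
      simp only [Fin.snoc_castSucc] at this
      simpa [hs] using this
    · have := h1 (Fin.castSucc_lt_last i)
      simp only [Fin.snoc_castSucc, Fin.snoc_last] at this
      simpa [inv_mul_lt_iff₀ hs] using this

/-- The law of the normalized partial sums of `n + 1` exponential variables is a multiple of
Lebesgue measure on the open simplex. -/
lemma exists_expPi_normalizedSums_mem (n : ℕ) : ∃ c : ENNReal, ∀ D : Set (Fin n → ℝ),
    MeasurableSet D → expPi (n + 1) (normalizedSums ⁻¹' D) = c * volume (openSimplex n ∩ D) := by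
  refine ⟨∫⁻ s in Set.Ioi (0 : ℝ), ENNReal.ofReal (Real.exp (-s)) *
    ENNReal.ofReal |((s⁻¹) ^ Module.finrank ℝ (Fin n → ℝ))⁻¹|, fun D hD => ?_⟩
  have hQ : MeasurableSet {x : Fin (n + 1) → ℝ | ∀ i, 0 < x i} := by
    rw [Set.ofPred_forall]
    exact MeasurableSet.iInter fun i => measurableSet_lt measurable_const (measurable_pi_apply i)
  have hK : MeasurableSet {y : Fin (n + 1) → ℝ | (StrictMono y ∧ 0 < y 0) ∧
      (fun i : Fin n => y i.castSucc / y (Fin.last n)) ∈ D} := by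
    refine (measurableSet_strictMono.inter
      (measurableSet_lt measurable_const (measurable_pi_apply 0))).inter ?_
    have : Measurable fun (y : Fin (n + 1) → ℝ) (i : Fin n) => y i.castSucc / y (Fin.last n) := by
      fun_prop
    exact this hD
  set K := {y : Fin (n + 1) → ℝ | (StrictMono y ∧ 0 < y 0) ∧
      (fun i : Fin n => y i.castSucc / y (Fin.last n)) ∈ D}
  have hg : Measurable (K.indicator fun y => ENNReal.ofReal (Real.exp (-y (Fin.last n)))) :=
    Measurable.indicator (by fun_prop) hK
  have h1 : expPi (n + 1) (normalizedSums ⁻¹' D) =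
      ∫⁻ y, K.indicator (fun y => ENNReal.ofReal (Real.exp (-y (Fin.last n)))) y := by
    rw [← (measurePreserving_partialSums (n + 1)).lintegral_comp hg, expPi_eq_withDensity,
      withDensity_apply _ (measurable_normalizedSums hD), Measure.restrict_restrict
      (measurable_normalizedSums hD), ← lintegral_indicator
      ((measurable_normalizedSums hD).inter hQ)]
    refine lintegral_congr fun x => ?_
    have hiff : x ∈ normalizedSums ⁻¹' D ∩ {x | ∀ i, 0 < x i} ↔ partialSums x ∈ K := by
      rw [Set.inter_comm]
      exact and_congr (forall_pos_iff_partialSums x) Iff.rfl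
    by_cases hx : partialSums x ∈ K
    · rw [Set.indicator_of_mem hx, Set.indicator_of_mem (hiff.2 hx), partialSums_last]
    · rw [Set.indicator_of_notMem hx, Set.indicator_of_notMem fun h => hx (hiff.1 h)]
  -- Integrate over the last partial sum s: each slice contributes e^{-s} times a power of s times
  -- the same simplex volume, so D separates from the s-integral.
  have hmp := (volume_preserving_piFinSuccAbove (fun _ : Fin (n + 1) => ℝ) (Fin.last n)).symm
  have hC : MeasurableSet (openSimplex n ∩ D) := (measurableSet_openSimplex n).inter hD
  rw [h1, hmp.lintegral_map_equiv, Measure.volume_eq_prod, lintegral_prod (fun a => K.indicator _ _)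
    (hg.comp hmp.measurable).aemeasurable, ← lintegral_mul_const _ (by fun_prop),
    ← lintegral_indicator measurableSet_Ioi]
  refine lintegral_congr fun s => ?_
  by_cases hs : 0 < s
  · have h2 : ∀ w : Fin n → ℝ, K.indicator (fun y => ENNReal.ofReal (Real.exp (-y (Fin.last n))))
        ((MeasurableEquiv.piFinSuccAbove (fun _ => ℝ) (Fin.last n)).symm (s, w)) =
        ((s⁻¹ • ·) ⁻¹' (openSimplex n ∩ D)).indicator
          (fun _ => ENNReal.ofReal (Real.exp (-s))) w := fun w => by
      have h3 : (MeasurableEquiv.piFinSuccAbove (fun _ => ℝ) (Fin.last n)).symm (s, w) =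
          (Fin.snoc w s : Fin (n + 1) → ℝ) := by simp [Fin.snocEquiv]
      have h4 : (Fin.snoc w s : Fin (n + 1) → ℝ) ∈ K ↔
          w ∈ (s⁻¹ • ·) ⁻¹' (openSimplex n ∩ D) := by
        refine and_congr (inv_smul_mem_openSimplex_iff hs).symm ?_
        have : (fun i : Fin n => (Fin.snoc w s : Fin (n + 1) → ℝ) i.castSucc /
            (Fin.snoc w s : Fin (n + 1) → ℝ) (Fin.last n)) = s⁻¹ • w := by
          ext i
          simp [div_eq_inv_mul]
        rw [this]
      rw [h3]
      by_cases hw : (Fin.snoc w s : Fin (n + 1) → ℝ) ∈ K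
      · rw [Set.indicator_of_mem hw, Set.indicator_of_mem (h4.1 hw), Fin.snoc_last]
      · rw [Set.indicator_of_notMem hw, Set.indicator_of_notMem fun h => hw (h4.2 h)]
    simp_rw [h2]
    rw [lintegral_indicator_const (measurable_const_smul s⁻¹ hC),
      Measure.addHaar_preimage_smul _ (inv_pos.2 hs).ne', Set.indicator_of_mem (Set.mem_Ioi.2 hs),
      mul_assoc]
  · rw [Set.indicator_of_notMem (fun h => hs (Set.mem_Ioi.1 h))]
    refine (lintegral_congr fun w => Set.indicator_of_notMem (fun hmem => hs ?_) _).trans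
      lintegral_zero
    have h3 := hmem.1.2.trans_le (hmem.1.1.monotone (Fin.zero_le (Fin.last n)))
    simpa using h3

/-- Both laws are multiples of Lebesgue measure on the simplex with total mass 1, so the factors
agree and the integral c need not be evaluated. -/
lemma map_orderStat_uniform_eq (n : ℕ) :
    (volume.restrict (Set.univ.pi fun _ : Fin n => Set.Ico (0 : ℝ) 1)).map orderStat =
      (expPi (n + 1)).map fun x => points (normalizedSums x) := by
  obtain ⟨c, hc⟩ := exists_expPi_normalizedSums_mem n
  have h1 : (n.factorial : ENNReal) * volume (openSimplex n) = 1 := by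
    have := volume_restrict_orderStat_mem (n := n) MeasurableSet.univ
    simpa [Set.preimage_univ, Real.volume_pi_Ico, volume_pi_pi] using this.symm
  have h2 : c * volume (openSimplex n) = 1 := by
    have := hc Set.univ MeasurableSet.univ
    simpa using this.symm
  have hc' : (n.factorial : ENNReal) = c := by
    rw [ENNReal.eq_inv_of_mul_eq_one_left h1, ENNReal.eq_inv_of_mul_eq_one_left h2]
  ext B hB
  rw [Measure.map_apply measurable_orderStat hB,
    Measure.map_apply (f := fun x => points (normalizedSums x))
      (measurable_points.comp measurable_normalizedSums) hB,
    volume_restrict_orderStat_mem hB, hc']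
  exact (hc _ (measurable_points hB)).symm

/-- The order statistics of independent uniform variables are distributed as the normalized
partial sums of independent exponential variables. -/
lemma hasLaw_orderStat {Ω : Type*} [MeasurableSpace Ω] {ν : Measure Ω} [IsProbabilityMeasure ν]
    {U : Fin n → Ω → ℝ} (hindep : iIndepFun U ν)
    (hunif : ∀ i, pdf.IsUniform (U i) (Set.Ico 0 1) ν volume) :
    HasLaw (fun ω => orderStat fun i => U i ω)
      ((expPi (n + 1)).map fun x => points (normalizedSums x)) ν := by
  have hm : ∀ i, AEMeasurable (U i) ν := fun i => (hunif i).aemeasurable (by simp) (by simp)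
  have hm' : AEMeasurable (fun ω i => U i ω) ν := aemeasurable_pi_lambda _ hm
  have h1 : ν.map (fun ω i => U i ω) =
      volume.restrict (Set.univ.pi fun _ : Fin n => Set.Ico (0 : ℝ) 1) := by
    rw [(iIndepFun_iff_map_fun_eq_pi_map hm).1 hindep, volume_pi, Measure.restrict_pi_pi]
    congr 1
    ext i : 1
    rw [hunif i, ProbabilityTheory.cond]
    simp
  refine ⟨measurable_orderStat.comp_aemeasurable hm', ?_⟩
  rw [← map_orderStat_uniform_eq, ← h1,
    AEMeasurable.map_map_of_aemeasurable measurable_orderStat.aemeasurable hm']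
  rfl

end

/-! ### The integral equation: uniqueness and the series solution. -/

lemma hasSum_of_eq {f g : ℕ → ℝ} {a b : ℝ} (h : HasSum g b) (hfg : ∀ j, f j = g j) (hab : a = b) :
    HasSum f a := by
  rw [hab, funext hfg]; exact h

/-- A bounded solution of the integral equation that vanishes at infinity is zero. -/
lemma eq_zero_of_integral_equation {R : ℝ → ℝ} {C : ℝ} (hC : ∀ t, 0 ≤ t → |R t| ≤ C)
    (hlim : Tendsto R atTop (𝓝 0))
    (heq : ∀ t, 0 ≤ t → Real.exp (-t) * R t = ∫ u in t..(2 * t), Real.exp (-u) * R u)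
    {t : ℝ} (ht : 0 ≤ t) : R t = 0 := by
  set S := sSup ((fun t => |R t|) '' Set.Ici 0)
  have hbdd : BddAbove ((fun t => |R t|) '' Set.Ici 0) :=
    ⟨C, by rintro _ ⟨t, ht, rfl⟩; exact hC t ht⟩
  have hle : ∀ t, 0 ≤ t → |R t| ≤ S := fun t ht => le_csSup hbdd ⟨t, ht, rfl⟩
  -- Since ∫_t^{2t} e^{-u} du = e^{-t} (1 - e^{-t}), the equation improves the bound S at each
  -- finite t.
  have hle' : ∀ t, 0 ≤ t → |R t| ≤ S * (1 - Real.exp (-t)) := fun t ht => by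
    have h1 : ‖∫ u in t..(2 * t), Real.exp (-u) * R u‖ ≤ ∫ u in t..(2 * t), Real.exp (-u) * S := by
      refine intervalIntegral.norm_integral_le_of_norm_le (by linarith) ?_
        ((by fun_prop : Continuous fun u => Real.exp (-u) * S).intervalIntegrable _ _)
      refine ae_of_all _ fun u hu => ?_
      rw [norm_mul, Real.norm_eq_abs, abs_of_pos (Real.exp_pos _)]
      exact mul_le_mul_of_nonneg_left (hle u (by linarith [hu.1])) (Real.exp_pos _).le
    have h2 : ∫ u in t..(2 * t), Real.exp (-u) * S =
        (Real.exp (-t) - Real.exp (-(2 * t))) * S := by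
      rw [intervalIntegral.integral_mul_const, intervalIntegral.integral_comp_neg (Real.exp ·),
        integral_exp]
    rw [← heq t ht, norm_mul, Real.norm_eq_abs, abs_of_pos (Real.exp_pos _), h2] at h1
    have h3 : Real.exp (-(2 * t)) = Real.exp (-t) * Real.exp (-t) := by
      rw [← Real.exp_add]; congr 1; ring
    rw [h3] at h1
    refine le_of_mul_le_mul_left (h1.trans_eq ?_) (Real.exp_pos (-t))
    ring
  have hS0 : 0 ≤ S := (abs_nonneg _).trans (hle 0 le_rfl)
  suffices S = 0 from abs_nonpos_iff.1 (this ▸ hle t ht)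
  by_contra hne
  have hSpos : 0 < S := lt_of_le_of_ne hS0 (Ne.symm hne)
  obtain ⟨T, hT⟩ := eventually_atTop.1
    ((tendsto_order.1 hlim.abs).2 (S / 2) (by simpa using hSpos))
  -- Beyond T the decay of R gives S/2; on [0, T] the improved bound is uniform. Both are below S, a
  -- contradiction.
  have hmax : S ≤ max (S / 2) (S * (1 - Real.exp (-T))) := by
    refine csSup_le ⟨_, 0, Set.self_mem_Ici, rfl⟩ ?_
    rintro _ ⟨s, hs, rfl⟩
    rcases le_total T s with h | h
    · exact (hT s h).le.trans (le_max_left _ _)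
    · refine (hle' s hs).trans (le_trans ?_ (le_max_right _ _))
      have := Real.exp_le_exp.2 (neg_le_neg h)
      gcongr
  have h1 : S * (1 - Real.exp (-T)) < S := by nlinarith [mul_pos hSpos (Real.exp_pos (-T))]
  exact absurd hmax (not_le.2 (max_lt (by linarith) h1))

/-- The coefficients of the series for the limiting distribution function. -/
noncomputable def seriesCoeff (j : ℕ) : ℝ :=
  (-1 : ℝ) ^ j * 2 ^ (j + 1) * ∏ l ∈ Finset.Icc 1 (j + 1), 1 / ((2 : ℝ) ^ l - 1)

lemma seriesCoeff_zero : seriesCoeff 0 = 2 := by norm_num [seriesCoeff]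

lemma seriesCoeff_succ (j : ℕ) : rate (j + 2) * seriesCoeff (j + 1) = -2 * seriesCoeff j := by
  have h := (rate_succ_pos (j + 1)).ne'
  rw [seriesCoeff, Finset.prod_Icc_succ_top (by omega)]
  change rate (j + 2) * ((-1) ^ (j + 1) * 2 ^ (j + 1 + 1) * (_ * (1 / rate (j + 2)))) = _
  rw [seriesCoeff]
  field_simp
  ring

lemma summable_abs_seriesCoeff : Summable fun j => |seriesCoeff j| := by
  refine summable_of_ratio_norm_eventually_le (r := 2 / 3) (by norm_num)
    (Eventually.of_forall fun j => ?_)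
  have h1 := congrArg abs (seriesCoeff_succ j)
  have h2 : (3 : ℝ) ≤ rate (j + 2) := by
    have : (1 : ℝ) ≤ 2 ^ j := one_le_pow₀ (by norm_num)
    rw [rate, pow_add]; linarith
  rw [abs_mul, abs_mul, abs_of_pos (by linarith : 0 < rate (j + 2))] at h1
  norm_num at h1 ⊢
  nlinarith [abs_nonneg (seriesCoeff (j + 1))]

lemma abs_seriesCoeff_mul_exp_le (j : ℕ) {t : ℝ} (ht : 0 ≤ t) :
    |seriesCoeff j * Real.exp (-rate (j + 1) * t)| ≤ |seriesCoeff j| * Real.exp (-t) := by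
  rw [abs_mul, abs_of_pos (Real.exp_pos _)]
  refine mul_le_mul_of_nonneg_left (Real.exp_le_exp.2 ?_) (abs_nonneg _)
  have : (1 : ℝ) ≤ 2 ^ j := one_le_pow₀ (by norm_num)
  have : 1 ≤ rate (j + 1) := by rw [rate, pow_succ]; linarith
  nlinarith

lemma summable_seriesCoeff_mul_exp {t : ℝ} (ht : 0 ≤ t) :
    Summable fun j => seriesCoeff j * Real.exp (-rate (j + 1) * t) :=
  Summable.of_norm_bounded (summable_abs_seriesCoeff.mul_right _)
    fun j => abs_seriesCoeff_mul_exp_le j ht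

/-- The series `1 - ∑_j a_j e^{-(2^{j+1}-1)t}`. -/
noncomputable def seriesCdf (t : ℝ) : ℝ :=
  1 - ∑' j, seriesCoeff j * Real.exp (-rate (j + 1) * t)

lemma continuousOn_seriesCdf : ContinuousOn seriesCdf (Set.Ici 0) := by
  refine continuousOn_const.sub (continuousOn_tsum (fun j => by fun_prop)
    summable_abs_seriesCoeff fun j t ht => ?_)
  exact (abs_seriesCoeff_mul_exp_le j ht).trans
    (mul_le_of_le_one_right (abs_nonneg _) (Real.exp_le_one_iff.2 (neg_nonpos.2 ht)))

lemma abs_seriesCdf_sub_one_le {t : ℝ} (ht : 0 ≤ t) :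
    |seriesCdf t - 1| ≤ (∑' j, |seriesCoeff j|) * Real.exp (-t) := by
  rw [seriesCdf, sub_sub_cancel_left, abs_neg, ← tsum_mul_right, ← Real.norm_eq_abs]
  exact tsum_of_norm_bounded (summable_abs_seriesCoeff.mul_right _).hasSum
    fun j => abs_seriesCoeff_mul_exp_le j ht

lemma tendsto_seriesCdf : Tendsto seriesCdf atTop (𝓝 1) := by
  rw [tendsto_iff_norm_sub_tendsto_zero]
  refine squeeze_zero' (Eventually.of_forall fun _ => norm_nonneg _)
    ((eventually_ge_atTop 0).mono fun t ht => abs_seriesCdf_sub_one_le ht) ?_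
  have := Real.tendsto_exp_neg_atTop_nhds_zero.const_mul (∑' j, |seriesCoeff j|)
  simpa using this

/-- The factor e^{-t} turns the exponents 2^{j+1} - 1 into 2^{j+1}, so that doubling t becomes an
index shift. -/
lemma exp_mul_seriesCdf {t : ℝ} (ht : 0 ≤ t) : HasSum
    (fun j => seriesCoeff j * Real.exp (-(2 ^ (j + 1) * t)))
    (Real.exp (-t) - Real.exp (-t) * seriesCdf t) := by
  have h := (summable_seriesCoeff_mul_exp ht).hasSum.mul_left (Real.exp (-t))
  refine hasSum_of_eq h (fun j => ?_) ?_
  · have : Real.exp (-(2 ^ (j + 1) * t)) = Real.exp (-t) * Real.exp (-rate (j + 1) * t) := by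
      rw [← Real.exp_add, rate]; congr 1; ring
    rw [this]; ring
  · rw [seriesCdf]; ring

lemma integral_exp_neg_mul {c : ℝ} (hc : c ≠ 0) (a b : ℝ) :
    ∫ u in a..b, Real.exp (-(c * u)) = c⁻¹ * (Real.exp (-(c * a)) - Real.exp (-(c * b))) := by
  have h := intervalIntegral.integral_comp_mul_left (a := a) (b := b)
    (fun x => Real.exp (-x)) hc
  rw [h, intervalIntegral.integral_comp_neg (Real.exp ·), integral_exp, smul_eq_mul]

/-- With E_j = e^{-2^j t}, termwise integration gives a_j 2^{-(j+1)} (E_{j+1} - E_{j+2}). By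
`seriesCoeff_succ` the difference of the two series collapses to E_1 = e^{-2t}, which is exactly
what the constant term 1 leaves over. -/
lemma seriesCdf_integral_equation {t : ℝ} (ht : 0 ≤ t) :
    Real.exp (-t) * seriesCdf t = ∫ u in t..(2 * t), Real.exp (-u) * seriesCdf u := by
  have hle : t ≤ 2 * t := by linarith
  have hI : HasSum (fun j => ∫ u in t..(2 * t), seriesCoeff j * Real.exp (-(2 ^ (j + 1) * u)))
      (∫ u in t..(2 * t), (Real.exp (-u) - Real.exp (-u) * seriesCdf u)) := by
    refine intervalIntegral.hasSum_integral_of_dominated_convergence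
      (bound := fun j _ => |seriesCoeff j|) (fun j => ?_) (fun j => ae_of_all _ fun u hu => ?_)
      (ae_of_all _ fun u _ => summable_abs_seriesCoeff) (by simp) (ae_of_all _ fun u hu => ?_)
    · exact (by fun_prop : Continuous fun u =>
        seriesCoeff j * Real.exp (-(2 ^ (j + 1) * u))).aestronglyMeasurable
    · rw [Set.uIoc_of_le hle] at hu
      have hu0 : 0 ≤ u := by linarith [hu.1]
      rw [norm_mul, Real.norm_eq_abs, Real.norm_eq_abs, abs_of_pos (Real.exp_pos _)]
      refine mul_le_of_le_one_right (abs_nonneg _) (Real.exp_le_one_iff.2 ?_)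
      have : 0 ≤ 2 ^ (j + 1) * u := by positivity
      linarith
    · rw [Set.uIoc_of_le hle] at hu
      exact exp_mul_seriesCdf (by linarith [hu.1])
  set E : ℕ → ℝ := fun j => Real.exp (-(2 ^ j * t)) with hE
  have hterm : ∀ j, ∫ u in t..(2 * t), seriesCoeff j * Real.exp (-(2 ^ (j + 1) * u)) =
      seriesCoeff j * ((2 ^ (j + 1))⁻¹ * (E (j + 1) - E (j + 2))) := fun j => by
    rw [intervalIntegral.integral_const_mul, integral_exp_neg_mul (by positivity)]
    have : (2 : ℝ) ^ (j + 1) * (2 * t) = 2 ^ (j + 2) * t := by ring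
    rw [this]
  simp_rw [hterm] at hI
  have hA := exp_mul_seriesCdf ht
  have hD := hA.sub hI
  have hsumE : ∀ k : ℕ,
      Summable fun j => seriesCoeff j * (2 ^ (j + 1))⁻¹ * E (j + k) := fun k => by
    refine Summable.of_norm_bounded summable_abs_seriesCoeff fun j => ?_
    rw [norm_mul, norm_mul, Real.norm_eq_abs, mul_assoc]
    refine mul_le_of_le_one_right (abs_nonneg _) ?_
    have h1 : ‖((2 : ℝ) ^ (j + 1))⁻¹‖ ≤ 1 := by
      rw [norm_inv, norm_pow, Real.norm_ofNat]
      exact inv_le_one_of_one_le₀ (one_le_pow₀ (by norm_num))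
    have h2 : ‖E (j + k)‖ ≤ 1 := by
      rw [Real.norm_eq_abs, abs_of_pos (Real.exp_pos _), Real.exp_le_one_iff]
      have : 0 ≤ 2 ^ (j + k) * t := by positivity
      linarith
    exact mul_le_one₀ h1 (norm_nonneg _) h2
  have hrec : ∀ j, seriesCoeff (j + 1) * (1 - (2 ^ (j + 2))⁻¹) =
      -(seriesCoeff j * (2 ^ (j + 1))⁻¹) := fun j => by
    have h1 := seriesCoeff_succ j
    have h2 : (2 : ℝ) ^ j ≠ 0 := by positivity
    rw [rate] at h1
    field_simp
    linear_combination 2 * 2 ^ j * h1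
  -- The term j = 0 is 2 (1 - 1/2) E_1 = E_1; the others are shifted by `hrec`.
  have hB : HasSum (fun j => seriesCoeff j * (1 - (2 ^ (j + 1))⁻¹) * E (j + 1))
      (E 1 - ∑' j, seriesCoeff j * (2 ^ (j + 1))⁻¹ * E (j + 2)) := by
    have h1 : HasSum (fun j => seriesCoeff (j + 1) * (1 - (2 ^ (j + 1 + 1))⁻¹) * E (j + 1 + 1))
        (-∑' j, seriesCoeff j * (2 ^ (j + 1))⁻¹ * E (j + 2)) := by
      refine hasSum_of_eq (hsumE 2).hasSum.neg (fun j => ?_) rfl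
      rw [hrec]; ring
    have h2 := (hasSum_nat_add_iff (f := fun j => seriesCoeff j * (1 - (2 ^ (j + 1))⁻¹) *
      E (j + 1)) 1).1 h1
    refine hasSum_of_eq h2 (fun _ => rfl) ?_
    norm_num [seriesCoeff_zero]; ring
  have hF := hB.add (hsumE 2).hasSum
  have hEq : Real.exp (-t) - Real.exp (-t) * seriesCdf t -
      (∫ u in t..(2 * t), (Real.exp (-u) - Real.exp (-u) * seriesCdf u)) = E 1 := by
    refine hD.unique ?_
    refine hasSum_of_eq hF (fun j => ?_) (by ring)
    change seriesCoeff j * E (j + 1) - _ = _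
    ring
  have hint : IntervalIntegrable (fun u => Real.exp (-u) * seriesCdf u) volume t (2 * t) := by
    refine ContinuousOn.intervalIntegrable (ContinuousOn.mul (by fun_prop) ?_)
    refine continuousOn_seriesCdf.mono fun u hu => ?_
    rw [Set.uIcc_of_le hle] at hu
    exact ht.trans hu.1
  rw [intervalIntegral.integral_sub
    ((by fun_prop : Continuous fun u : ℝ => Real.exp (-u)).intervalIntegrable _ _) hint,
    intervalIntegral.integral_comp_neg (Real.exp ·), integral_exp] at hEq
  simp only [hE, pow_one] at hEq
  linarith

lemma eq_seriesCdf_of_integral_equation {P : ℝ → ℝ} (hm : Measurable P) (h0 : ∀ t, 0 ≤ P t)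
    (h1 : ∀ t, P t ≤ 1) (hlim : Tendsto P atTop (𝓝 1))
    (heq : ∀ t, 0 ≤ t → Real.exp (-t) * P t = ∫ u in t..(2 * t), Real.exp (-u) * P u)
    {t : ℝ} (ht : 0 ≤ t) : P t = seriesCdf t := by
  refine sub_eq_zero.1 (eq_zero_of_integral_equation (R := fun t => P t - seriesCdf t)
    (C := 1 + ∑' j, |seriesCoeff j|) (fun s hs => ?_)
    (by simpa using hlim.sub tendsto_seriesCdf) (fun s hs => ?_) ht)
  · have h2 := abs_seriesCdf_sub_one_le hs
    have h3 : (∑' j, |seriesCoeff j|) * Real.exp (-s) ≤ ∑' j, |seriesCoeff j| :=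
      mul_le_of_le_one_right (tsum_nonneg fun _ => abs_nonneg _)
        (Real.exp_le_one_iff.2 (by linarith))
    have h4 : |P s - 1| ≤ 1 := abs_le.2 ⟨by linarith [h0 s], by linarith [h1 s]⟩
    have h5 := abs_sub_le (P s) 1 (seriesCdf s)
    rw [abs_sub_comm 1] at h5
    linarith
  · have hle : s ≤ 2 * s := by linarith
    simp_rw [mul_sub]
    rw [heq s hs, seriesCdf_integral_equation hs, intervalIntegral.integral_sub]
    · refine (intervalIntegrable_iff_integrableOn_Ioc_of_le hle).2 ?_
      refine Measure.integrableOn_of_bounded (M := 1) (by simp) (by fun_prop)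
        ((ae_restrict_iff' measurableSet_Ioc).2 (ae_of_all _ fun u hu => ?_))
      rw [norm_mul, Real.norm_eq_abs, Real.norm_eq_abs, abs_of_pos (Real.exp_pos _),
        abs_of_nonneg (h0 u)]
      exact mul_le_one₀ (Real.exp_le_one_iff.2 (by linarith [hu.1])) (h0 u) (h1 u)
    · refine ContinuousOn.intervalIntegrable (ContinuousOn.mul (by fun_prop) ?_)
      refine continuousOn_seriesCdf.mono fun u hu => ?_
      rw [Set.uIcc_of_le hle] at hu
      exact hs.trans hu.1

/-! ### Exponential mean and pathwise limits under the law of large numbers. -/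

lemma integral_expMeasure_one (f : ℝ → ℝ) :
    ∫ x, f x ∂expMeasure 1 = ∫ x in Set.Ioi 0, Real.exp (-x) * f x := by
  rw [expMeasure_one_eq, integral_withDensity_eq_integral_toReal_smul (by fun_prop) (by simp)]
  simp [(Real.exp_pos _).le]

lemma integral_id_expMeasure_one : ∫ x, x ∂expMeasure 1 = 1 := by
  have h := Real.Gamma_eq_integral (s := 2) (by norm_num)
  rw [Real.Gamma_two] at h
  rw [integral_expMeasure_one, h]
  norm_num

/-- A non-integrable function has integral 0 by convention, but this integral is 1. -/
lemma integrable_id_expMeasure_one : Integrable (fun x => x) (expMeasure 1) := by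
  by_contra h
  have h1 := integral_undef h
  rw [integral_id_expMeasure_one] at h1
  exact one_ne_zero h1

section Deterministic

variable {x : ℕ → ℝ}

lemma coeff_le (j : ℕ) : coeff j ≤ (1 / 2) ^ j := by
  have h : (1 : ℝ) ≤ 2 ^ j := one_le_pow₀ (by norm_num)
  rw [coeff, one_div_pow]
  refine one_div_le_one_div_of_le (by positivity) ?_
  rw [pow_succ]; linarith

/-- Bounded averages of positive terms force x_j ≤ C (j + 1), which the geometric decay of the
coefficients absorbs. -/
lemma summable_coeff_mul (hx : ∀ j, 0 < x j)
    (hlim : Tendsto (fun n : ℕ => (∑ i ∈ Finset.range n, x i) / n) atTop (𝓝 1)) :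
    Summable fun j => coeff j * x j := by
  obtain ⟨C, hC⟩ := hlim.bddAbove_range
  have hC' : ∀ j : ℕ, x j ≤ C * (j + 1) := fun j => by
    have h1 : (∑ i ∈ Finset.range (j + 1), x i) / ((j + 1 : ℕ) : ℝ) ≤ C := hC ⟨j + 1, rfl⟩
    rw [div_le_iff₀ (by positivity)] at h1
    have h2 := Finset.single_le_sum (f := x) (fun i _ => (hx i).le) (Finset.self_mem_range_succ j)
    push_cast at h1
    linarith
  have hs : Summable fun j : ℕ => ((j : ℝ) ^ 1 * (1 / 2 : ℝ) ^ j + (1 / 2 : ℝ) ^ j) * C :=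
    ((summable_pow_mul_geometric_of_norm_lt_one 1 (by norm_num)).add
      (summable_geometric_of_lt_one (by norm_num) (by norm_num))).mul_right C
  refine Summable.of_nonneg_of_le (fun j => (mul_pos (coeff_pos j) (hx j)).le) (fun j => ?_) hs
  calc coeff j * x j ≤ (1 / 2) ^ j * (C * (j + 1)) :=
        mul_le_mul (coeff_le j) (hC' j) (hx j).le (by positivity)
    _ = _ := by ring

lemma tendsto_succ_div_sum
    (hlim : Tendsto (fun n : ℕ => (∑ i ∈ Finset.range n, x i) / n) atTop (𝓝 1)) :
    Tendsto (fun n : ℕ => ((n : ℝ) + 1) / ∑ i ∈ Finset.range (n + 1), x i) atTop (𝓝 1) := by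
  have h := (hlim.comp (tendsto_add_atTop_nat 1)).inv₀ one_ne_zero
  simpa [Function.comp_def, inv_div] using h

/-- With S_j = ∑_{i<j} x_i the gain is S_{j+1} - 2 S_j; divided by j + 1 it tends to 1 - 2 = -1, so
gains are eventually nonpositive. -/
lemma bddAbove_gains
    (hlim : Tendsto (fun n : ℕ => (∑ i ∈ Finset.range n, x i) / n) atTop (𝓝 1)) :
    BddAbove (Set.range fun j => x j - ∑ i ∈ Finset.range j, x i) := by
  have h1 := (hlim.comp (tendsto_add_atTop_nat 1)).sub ((hlim.const_mul 2).mul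
    (tendsto_natCast_div_add_atTop (1 : ℝ)))
  have h2 : ∀ᶠ j : ℕ in atTop, x j - ∑ i ∈ Finset.range j, x i ≤ 0 := by
    filter_upwards [(tendsto_order.1 h1).2 0 (by norm_num), eventually_gt_atTop 0] with j hj hj0
    have hj0' : (0 : ℝ) < j := by exact_mod_cast hj0
    simp only [Function.comp_apply, Finset.sum_range_succ] at hj
    push_cast at hj
    have h3 : 2 * ((∑ i ∈ Finset.range j, x i) / j) * (j / (j + 1)) =
        2 * (∑ i ∈ Finset.range j, x i) / (j + 1) := by field_simp
    rw [h3, ← sub_div, div_lt_iff₀ (by positivity)] at hj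
    linarith
  exact (isBoundedUnder_of_eventually_le h2).bddAbove_range

lemma tendsto_sup'_fin {a : ℕ → ℝ} (ha : BddAbove (Set.range a)) :
    Tendsto (fun m : ℕ => Finset.univ.sup' Finset.univ_nonempty fun i : Fin (m + 1) => a i)
      atTop (𝓝 (⨆ j, a j)) := by
  refine tendsto_order.2 ⟨fun b hb => ?_, fun b hb => Eventually.of_forall fun m => ?_⟩
  · obtain ⟨j, hj⟩ := exists_lt_of_lt_ciSup hb
    filter_upwards [eventually_ge_atTop j] with m hm
    exact hj.trans_le (Finset.le_sup' (fun i : Fin (m + 1) => a i)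
      (Finset.mem_univ (⟨j, by omega⟩ : Fin (m + 1))))
  · refine lt_of_le_of_lt (Finset.sup'_le _ _ ?_) hb
    exact fun i _ => le_ciSup ha (i : ℕ)

lemma partialSums_eq_sum_range (n : ℕ) (i : Fin (n + 1)) :
    partialSums (fun j : Fin (n + 1) => x j) i = ∑ j ∈ Finset.range (i + 1), x j := by
  induction i using Fin.induction with
  | zero => simp [partialSums_zero]
  | succ i ih =>
    rw [partialSums_succ, ih, Fin.val_succ, Finset.sum_range_succ _ (i + 1 : ℕ)]
    simp

lemma points_normalizedSums (n : ℕ) (h : ∑ j ∈ Finset.range (n + 1), x j ≠ 0)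
    (i : Fin (n + 2)) : points (normalizedSums fun j : Fin (n + 1) => x j) i =
      (∑ j ∈ Finset.range i, x j) / ∑ j ∈ Finset.range (n + 1), x j := by
  revert i
  refine forall_fin_add_two.2 ⟨by simp, fun i => ?_, ?_⟩
  · simp [normalizedSums, partialSums_eq_sum_range]
  · rw [points_succ_last, Fin.val_succ, Fin.val_last, div_self h]

/-- The weighted spacings as a function of the order statistics. -/
noncomputable def weightedIncrements {m : ℕ} (v : Fin (m + 2) → ℝ) : ℝ :=
  ((m : ℝ) + 1) * ∑ i : Fin (m + 1), coeff i * (v i.succ - v i.castSucc)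

/-- The maximal gain as a function of the order statistics. -/
noncomputable def maxIncrementGain {m : ℕ} (v : Fin (m + 2) → ℝ) : ℝ :=
  ((m : ℝ) + 1) * Finset.univ.sup' Finset.univ_nonempty
    fun i : Fin (m + 1) => v i.succ - v i.castSucc - v i.castSucc

lemma measurable_weightedIncrements (m : ℕ) :
    Measurable (weightedIncrements : (Fin (m + 2) → ℝ) → ℝ) := by
  unfold weightedIncrements; fun_prop

lemma measurable_maxIncrementGain (m : ℕ) :
    Measurable (maxIncrementGain : (Fin (m + 2) → ℝ) → ℝ) := by
  have h : Measurable (Finset.univ.sup' Finset.univ_nonempty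
    fun (i : Fin (m + 1)) (v : Fin (m + 2) → ℝ) => v i.succ - v i.castSucc - v i.castSucc) :=
    Finset.measurable_sup' _ fun i _ => by fun_prop
  unfold maxIncrementGain
  refine Measurable.const_mul ?_ _
  convert h using 1
  ext v
  rw [Finset.sup'_apply]

lemma weightedIncrements_points (m : ℕ) (h : ∑ j ∈ Finset.range (m + 1), x j ≠ 0) :
    weightedIncrements (points (normalizedSums fun j : Fin (m + 1) => x j)) =
      ((m : ℝ) + 1) / (∑ j ∈ Finset.range (m + 1), x j) *
        ∑ j ∈ Finset.range (m + 1), coeff j * x j := by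
  simp_rw [weightedIncrements, points_normalizedSums m h, Fin.val_succ, Fin.val_castSucc,
    Finset.sum_range_succ _ (Fin.val _), ← sub_div, add_sub_cancel_left]
  rw [Fin.sum_univ_eq_sum_range
    (fun i => coeff i * (x i / ∑ j ∈ Finset.range (m + 1), x j)) (m + 1), Finset.mul_sum,
    Finset.mul_sum]
  exact Finset.sum_congr rfl fun i _ => by ring

lemma maxIncrementGain_points (m : ℕ) (h : 0 < ∑ j ∈ Finset.range (m + 1), x j) :
    maxIncrementGain (points (normalizedSums fun j : Fin (m + 1) => x j)) =
      ((m : ℝ) + 1) / (∑ j ∈ Finset.range (m + 1), x j) *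
        Finset.univ.sup' Finset.univ_nonempty
          fun i : Fin (m + 1) => x i - ∑ j ∈ Finset.range i, x j := by
  have hmono : Monotone fun y : ℝ => y / ∑ j ∈ Finset.range (m + 1), x j :=
    fun a b hab => div_le_div_of_nonneg_right hab h.le
  simp_rw [maxIncrementGain, points_normalizedSums m h.ne', Fin.val_succ, Fin.val_castSucc,
    Finset.sum_range_succ _ (Fin.val _), ← sub_div, add_sub_cancel_left]
  rw [div_mul_eq_mul_div, mul_div_assoc]
  congr 1
  exact (Finset.apply_sup'_eq_sup'_comp Finset.univ_nonempty
    (fun y : ℝ => y / ∑ j ∈ Finset.range (m + 1), x j) hmono.map_sup).symm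

end Deterministic

/-! ### Distribution functions and convergence in distribution. -/

section DistFun

variable {Ω' : Type*} [MeasurableSpace Ω'] {μ : Measure Ω'}

lemma distFun_nonneg (Y : Ω' → ℝ) (t : ℝ) : 0 ≤ distFun μ Y t := measureReal_nonneg

lemma distFun_eq_zero_of_neg {Y : Ω' → ℝ} (hY : ∀ᵐ ω ∂μ, 0 ≤ Y ω) {t : ℝ} (ht : t < 0) :
    distFun μ Y t = 0 := by
  have h : μ {ω | Y ω ≤ t} = 0 := by
    refine measure_mono_null (fun ω hω => ?_) (ae_iff.1 hY)
    exact not_le.2 (lt_of_le_of_lt hω ht)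
  simp [distFun, measureReal_def, h]

variable [IsProbabilityMeasure μ]

lemma distFun_le_one (Y : Ω' → ℝ) (t : ℝ) : distFun μ Y t ≤ 1 := measureReal_le_one

lemma monotone_distFun (Y : Ω' → ℝ) : Monotone (distFun μ Y) :=
  fun _ _ hst => measureReal_mono fun _ h => le_trans h hst

lemma distFun_eq_cdf {Y : Ω' → ℝ} (hY : AEMeasurable Y μ) : distFun μ Y = cdf (μ.map Y) := by
  have := Measure.isProbabilityMeasure_map hY
  ext t
  rw [cdf_eq_real, map_measureReal_apply_of_aemeasurable hY measurableSet_Iic]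
  rfl

/-- Portmanteau for (-∞, t], whose boundary {t} is null because the limiting distribution function
is continuous. -/
lemma tendsto_distFun_of_tendstoInDistribution {Ω : ℕ → Type*} [∀ m, MeasurableSpace (Ω m)]
    {ν : ∀ m, Measure (Ω m)} [∀ m, IsProbabilityMeasure (ν m)] {Y : ∀ m, Ω m → ℝ} {Z : Ω' → ℝ}
    (h : TendstoInDistribution Y atTop Z ν μ) (hc : Continuous (distFun μ Z)) (t : ℝ) :
    Tendsto (fun m => distFun (ν m) (Y m) t) atTop (𝓝 (distFun μ Z t)) := by
  have := Measure.isProbabilityMeasure_map h.aemeasurable_limit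
  rw [distFun_eq_cdf h.aemeasurable_limit] at hc
  have h0 : (μ.map Z) (frontier (Set.Iic t)) = 0 := by
    rw [frontier_Iic, ← measure_cdf (μ.map Z), StieltjesFunction.measure_singleton,
      hc.continuousAt.continuousWithinAt.leftLim_eq, sub_self, ENNReal.ofReal_zero]
  have h1 := ProbabilityMeasure.tendsto_measure_of_null_frontier_of_tendsto' h.tendsto h0
  have h2 := (ENNReal.tendsto_toReal (by simp)).comp h1
  simp only [Function.comp_def, ProbabilityMeasure.coe_mk] at h2
  rw [Measure.map_apply_of_aemeasurable h.aemeasurable_limit measurableSet_Iic] at h2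
  refine h2.congr fun m => ?_
  rw [Measure.map_apply_of_aemeasurable (h.forall_aemeasurable m) measurableSet_Iic]
  rfl

/-- The variables `Y m` live on unrelated spaces; convergence in distribution sees only their laws,
so copies converging almost surely on one space suffice. -/
lemma tendstoInDistribution_of_identDistrib_ae {Ω : ℕ → Type*} [∀ m, MeasurableSpace (Ω m)]
    {ν : ∀ m, Measure (Ω m)} [∀ m, IsProbabilityMeasure (ν m)] {Y : ∀ m, Ω m → ℝ}
    {W : ℕ → Ω' → ℝ} {Z : Ω' → ℝ} (hYW : ∀ m, IdentDistrib (Y m) (W m) (ν m) μ)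
    (hW : ∀ᵐ ω ∂μ, Tendsto (fun m => W m ω) atTop (𝓝 (Z ω))) :
    TendstoInDistribution Y atTop Z ν μ := by
  have hZ : AEMeasurable Z μ :=
    aemeasurable_of_tendsto_metrizable_ae _ (fun m => (hYW m).aemeasurable_snd) hW
  have h := tendstoInDistribution_of_ae_tendsto (fun m => (hYW m).aemeasurable_snd) hZ hW
  refine ⟨fun m => (hYW m).aemeasurable_fst, hZ, ?_⟩
  refine h.tendsto.congr fun m => Subtype.ext ?_
  exact (hYW m).map_eq.symm

end DistFun

/-! ### Passage to infinitely many exponential variables. -/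

section Exponential

variable {Ω' : Type*} [MeasurableSpace Ω'] {μ : Measure Ω'}
  {X : ℕ → Ω' → ℝ}

lemma ae_pos_and_tendsto (hindep : iIndepFun X μ) (hexp : ∀ j, HasLaw (X j) (expMeasure 1) μ) :
    ∀ᵐ ω ∂μ, (∀ j, 0 < X j ω) ∧
      Tendsto (fun n : ℕ => (∑ i ∈ Finset.range n, X i ω) / n) atTop (𝓝 1) := by
  have h1 : ∀ᵐ ω ∂μ, ∀ j, 0 < X j ω := ae_all_iff.2 fun j =>
    ae_of_ae_map (hexp j).aemeasurable ((hexp j).map_eq ▸ ae_pos_expMeasure_one)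
  have hint : Integrable (X 0) μ := by
    have := integrable_id_expMeasure_one
    rw [← (hexp 0).map_eq] at this
    exact this.comp_aemeasurable (hexp 0).aemeasurable
  have hmean : ∫ ω, X 0 ω ∂μ = 1 := by
    rw [← integral_id_expMeasure_one, ← (hexp 0).map_eq,
      integral_map (hexp 0).aemeasurable (by fun_prop)]
  have h2 := strong_law_ae_real X hint (fun i j hij => hindep.indepFun hij)
    fun i => ⟨(hexp i).aemeasurable, (hexp 0).aemeasurable,
      (hexp i).map_eq.trans (hexp 0).map_eq.symm⟩
  rw [hmean] at h2
  filter_upwards [h1, h2] with ω h1 h2 using ⟨h1, h2⟩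

/-- The supremum of the gains `x_j - (x_0 + ⋯ + x_{j-1})`. -/
noncomputable def supGain (x : ℕ → ℝ) : ℝ := ⨆ j, (x j - ∑ i ∈ Finset.range j, x i)

lemma ae_nonneg_limitSum (hindep : iIndepFun X μ) (hexp : ∀ j, HasLaw (X j) (expMeasure 1) μ) :
    ∀ᵐ ω ∂μ, 0 ≤ limitSum fun j => X j ω := by
  filter_upwards [ae_pos_and_tendsto hindep hexp] with ω hω
  exact tsum_nonneg fun j => (mul_pos (coeff_pos j) (hω.1 j)).le

lemma ae_nonneg_supGain (hindep : iIndepFun X μ) (hexp : ∀ j, HasLaw (X j) (expMeasure 1) μ) :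
    ∀ᵐ ω ∂μ, 0 ≤ supGain fun j => X j ω := by
  filter_upwards [ae_pos_and_tendsto hindep hexp] with ω hω
  refine (hω.1 0).le.trans ?_
  simpa using! le_ciSup (bddAbove_gains hω.2) 0

variable [IsProbabilityMeasure μ]

lemma hasLaw_expPi (hindep : iIndepFun X μ) (hexp : ∀ j, HasLaw (X j) (expMeasure 1) μ) (n : ℕ) :
    HasLaw (fun ω (i : Fin n) => X i ω) (expPi n) μ := by
  have hm : ∀ i : Fin n, AEMeasurable (X i) μ := fun i => (hexp i).aemeasurable
  refine ⟨aemeasurable_pi_lambda _ hm, ?_⟩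
  rw [(iIndepFun_iff_map_fun_eq_pi_map hm).1 (hindep.precomp Fin.val_injective)]
  simp_rw [(hexp _).map_eq]

lemma hypoCdf_le_one (n : ℕ) {t : ℝ} (ht : 0 ≤ t) : hypoCdf n t ≤ 1 := by
  have h := prob_le_one (μ := expPi n) (s := {x | ∑ i : Fin _, coeff i * x i ≤ t})
  rwa [expPi_weightedSum_le n ht, ENNReal.ofReal_le_one] at h

/-- Continuity from above, stated once for both the weighted sums and the maximal gains. -/
lemma tendsto_hypoCdf_of_iInter {Y : Ω' → ℝ} {t : ℝ} (ht : 0 ≤ t) {s : (n : ℕ) → Set (Fin n → ℝ)}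
    (hlaw : ∀ n, HasLaw (fun ω (i : Fin n) => X i ω) (expPi n) μ)
    (hs : ∀ n, MeasurableSet (s n)) (hps : ∀ n, expPi n (s n) = ENNReal.ofReal (hypoCdf n t))
    (hanti : ∀ᵐ ω ∂μ, Antitone fun n => (fun i : Fin n => X i ω) ∈ s n)
    (hY : ∀ᵐ ω ∂μ, Y ω ≤ t ↔ ∀ n, (fun i : Fin n => X i ω) ∈ s n) :
    Tendsto (fun n => hypoCdf n t) atTop (𝓝 (distFun μ Y t)) := by
  set A : ℕ → Set Ω' := fun n => {ω | (fun i : Fin n => X i ω) ∈ s n} with hA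
  -- The events decrease only almost surely; intersecting with G makes them decrease everywhere.
  set G : Set Ω' := {ω | Antitone fun n => (fun i : Fin n => X i ω) ∈ s n} with hG
  have hGn : NullMeasurableSet G μ :=
    NullMeasurableSet.of_compl (NullMeasurableSet.of_null (ae_iff.1 hanti))
  have hAn : ∀ n, NullMeasurableSet (A n) μ := fun n =>
    (hlaw n).aemeasurable.nullMeasurable (hs n)
  have hAG : ∀ n, μ (A n ∩ G) = ENNReal.ofReal (hypoCdf n t) := fun n => by
    rw [← hps n, ← (hlaw n).map_eq, Measure.map_apply_of_aemeasurable (hlaw n).aemeasurable (hs n)]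
    refine measure_congr ?_
    filter_upwards [hanti] with ω hω
    exact propext ⟨fun h => h.1, fun h => ⟨h, hω⟩⟩
  have h1 := tendsto_measure_iInter_atTop (μ := μ) (s := fun n => A n ∩ G)
    (fun n => (hAn n).inter hGn)
    (fun m n hmn ω hω => ⟨hω.2 hmn hω.1, hω.2⟩) ⟨0, measure_ne_top _ _⟩
  have h2 : μ (⋂ n, A n ∩ G) = μ {ω | Y ω ≤ t} := by
    refine measure_congr ?_
    filter_upwards [hanti, hY] with ω hω hYω
    refine propext ⟨fun h => hYω.2 fun n => (Set.mem_iInter.1 h n).1,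
      fun h => Set.mem_iInter.2 fun n => ⟨hYω.1 h n, hω⟩⟩
  simp only [Function.comp_def, hAG] at h1
  rw [h2] at h1
  have h3 := (ENNReal.tendsto_toReal (measure_ne_top μ _)).comp h1
  refine h3.congr fun n => ?_
  exact ENNReal.toReal_ofReal (hypoCdf_nonneg n ht)

lemma tendsto_hypoCdf_limitSum (hindep : iIndepFun X μ)
    (hexp : ∀ j, HasLaw (X j) (expMeasure 1) μ) {t : ℝ} (ht : 0 ≤ t) :
    Tendsto (fun n => hypoCdf n t) atTop (𝓝 (distFun μ (fun ω => limitSum fun j => X j ω) t)) := by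
  refine tendsto_hypoCdf_of_iInter ht (hasLaw_expPi hindep hexp)
    (s := fun n => {x | ∑ i : Fin n, coeff i * x i ≤ t})
    (fun n => measurableSet_weightedSum_le n t) (fun n => expPi_weightedSum_le n ht) ?_ ?_
  · filter_upwards [ae_pos_and_tendsto hindep hexp] with ω hω
    intro m n hmn h
    change ∑ i : Fin n, coeff i * X i ω ≤ t at h
    rw [Fin.sum_univ_eq_sum_range (fun i => coeff i * X i ω)] at h ⊢
    refine (Finset.sum_le_sum_of_subset_of_nonneg (Finset.range_mono hmn) fun i _ _ => ?_).trans h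
    exact (mul_pos (coeff_pos i) (hω.1 i)).le
  · filter_upwards [ae_pos_and_tendsto hindep hexp] with ω hω
    have hsum := summable_coeff_mul hω.1 hω.2
    change _ ↔ ∀ n, ∑ i : Fin n, coeff i * X i ω ≤ t
    simp_rw [fun n => Fin.sum_univ_eq_sum_range (fun i => coeff i * X i ω) n]
    refine ⟨fun h n => ?_, fun h => ?_⟩
    · exact (hsum.sum_le_tsum _ fun i _ => (mul_pos (coeff_pos i) (hω.1 i)).le).trans h
    · exact hsum.tsum_le_of_sum_range_le h

lemma sum_filter_lt_eq_sum_range (x : ℕ → ℝ) {n : ℕ} (i : Fin n) :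
    ∑ j : Fin n with j < i, x j = ∑ j ∈ Finset.range i, x j := by
  simp_rw [Finset.sum_filter, Fin.lt_def]
  rw [Fin.sum_univ_eq_sum_range (fun j => if j < (i : ℕ) then x j else 0) n, ← Finset.sum_filter]
  congr 1
  ext j
  simp only [Finset.mem_filter, Finset.mem_range]
  omega

lemma tendsto_hypoCdf_supGain (hindep : iIndepFun X μ)
    (hexp : ∀ j, HasLaw (X j) (expMeasure 1) μ) {t : ℝ} (ht : 0 ≤ t) :
    Tendsto (fun n => hypoCdf n t) atTop (𝓝 (distFun μ (fun ω => supGain fun j => X j ω) t)) := by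
  have hiff : ∀ ω n, (fun i : Fin n => X i ω) ∈
      {x : Fin n → ℝ | ∀ i, x i - ∑ j with j < i, x j ≤ t} ↔
      ∀ i < n, X i ω - ∑ j ∈ Finset.range i, X j ω ≤ t := fun ω n => by
    simp only [Set.mem_ofPred_eq]
    simp_rw [fun i => sum_filter_lt_eq_sum_range (fun j => X j ω) (n := n) i]
    exact ⟨fun h i hi => h ⟨i, hi⟩, fun h i => h i i.2⟩
  refine tendsto_hypoCdf_of_iInter ht (hasLaw_expPi hindep hexp)
    (s := fun n => {x | ∀ i, x i - ∑ j with j < i, x j ≤ t})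
    (fun n => measurableSet_gains_le n t) (fun n => expPi_gains_le n ht) ?_ ?_
  · refine ae_of_all _ fun ω m n hmn h => ?_
    have h' := (hiff ω n).1 h
    exact (hiff ω m).2 fun i hi => h' i (hi.trans_le hmn)
  · filter_upwards [ae_pos_and_tendsto hindep hexp] with ω hω
    have hb := bddAbove_gains hω.2
    refine Iff.trans ?_ (forall_congr' fun n => (hiff ω n).symm)
    rw [supGain, ciSup_le_iff hb]
    exact ⟨fun h n i _ => h i, fun h i => h (i + 1) i (Nat.lt_succ_self i)⟩

lemma distFun_supGain (hindep : iIndepFun X μ) (hexp : ∀ j, HasLaw (X j) (expMeasure 1) μ) :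
    distFun μ (fun ω => supGain fun j => X j ω) =
      distFun μ fun ω => limitSum fun j => X j ω := by
  ext t
  rcases lt_or_ge t 0 with ht | ht
  · rw [distFun_eq_zero_of_neg (ae_nonneg_supGain hindep hexp) ht,
      distFun_eq_zero_of_neg (ae_nonneg_limitSum hindep hexp) ht]
  · exact tendsto_nhds_unique (tendsto_hypoCdf_supGain hindep hexp ht)
      (tendsto_hypoCdf_limitSum hindep hexp ht)

lemma distFun_limitSum_integral_equation (hindep : iIndepFun X μ)
    (hexp : ∀ j, HasLaw (X j) (expMeasure 1) μ) (t : ℝ) :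
    Real.exp (-t) * distFun μ (fun ω => limitSum fun j => X j ω) t =
      ∫ u in t..(2 * t), Real.exp (-u) * distFun μ (fun ω => limitSum fun j => X j ω) u := by
  rcases lt_or_ge t 0 with ht | ht
  -- For t < 0 the integration range [2t, t] is negative, where P vanishes.
  · have h0 := fun {s : ℝ} (hs : s < 0) =>
      distFun_eq_zero_of_neg (ae_nonneg_limitSum hindep hexp) hs
    rw [h0 ht, mul_zero, intervalIntegral.integral_congr (g := fun _ => 0) (fun u hu => ?_)]
    · simp
    · rw [Set.uIcc_of_ge (by linarith)] at hu
      simp only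
      rw [h0 (by linarith [hu.2]), mul_zero]
  · have hle : t ≤ 2 * t := by linarith
    have h1 := ((tendsto_hypoCdf_limitSum hindep hexp ht).comp
      (tendsto_add_atTop_nat 1)).const_mul (Real.exp (-t))
    simp only [Function.comp_def, exp_mul_hypoCdf_succ] at h1
    refine tendsto_nhds_unique h1 ?_
    refine intervalIntegral.tendsto_integral_filter_of_dominated_convergence (fun _ => 1)
      (Eventually.of_forall fun n => ?_) (Eventually.of_forall fun n => ae_of_all _ fun u hu => ?_)
      (by simp) (ae_of_all _ fun u hu => ?_)
    · have := continuous_hypoCdf n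
      exact (by fun_prop : Continuous fun u => Real.exp (-u) * hypoCdf n u).aestronglyMeasurable
    · rw [Set.uIoc_of_le hle] at hu
      have hu0 : 0 ≤ u := by linarith [hu.1]
      rw [norm_mul, Real.norm_eq_abs, Real.norm_eq_abs, abs_of_pos (Real.exp_pos _),
        abs_of_nonneg (hypoCdf_nonneg n hu0)]
      exact mul_le_one₀ (Real.exp_le_one_iff.2 (by linarith)) (hypoCdf_nonneg n hu0)
        (hypoCdf_le_one n hu0)
    · rw [Set.uIoc_of_le hle] at hu
      exact (tendsto_hypoCdf_limitSum hindep hexp (by linarith [hu.1])).const_mul _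

/-- The integral equation writes P as e^t times a difference of primitives, and these are continuous
because P is monotone, hence locally integrable. -/
lemma continuous_distFun_limitSum (hindep : iIndepFun X μ)
    (hexp : ∀ j, HasLaw (X j) (expMeasure 1) μ) :
    Continuous (distFun μ fun ω => limitSum fun j => X j ω) := by
  set P := distFun μ fun ω => limitSum fun j => X j ω with hP
  have hint : ∀ a b, IntervalIntegrable (fun u => Real.exp (-u) * P u) volume a b := fun a b =>
    (monotone_distFun _).intervalIntegrable.continuousOn_mul (by fun_prop)
  have hF := intervalIntegral.continuous_primitive hint 0
  have h : P = fun t => Real.exp t * ((∫ u in (0 : ℝ)..(2 * t), Real.exp (-u) * P u) -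
      ∫ u in (0 : ℝ)..t, Real.exp (-u) * P u) := by
    ext t
    rw [intervalIntegral.integral_interval_sub_left (hint _ _) (hint _ _),
      ← distFun_limitSum_integral_equation hindep hexp t, ← mul_assoc, ← Real.exp_add]
    simp [hP]
  rw [h]
  exact Real.continuous_exp.mul ((hF.comp (continuous_const_mul 2)).sub hF)

lemma identDistrib_orderStat {Ω : Type*} [MeasurableSpace Ω] {ν : Measure Ω}
    [IsProbabilityMeasure ν] {m : ℕ} {U : Fin m → Ω → ℝ} (hU : iIndepFun U ν)
    (hunif : ∀ i, pdf.IsUniform (U i) (Set.Ico 0 1) ν volume) (hindep : iIndepFun X μ)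
    (hexp : ∀ j, HasLaw (X j) (expMeasure 1) μ) :
    IdentDistrib (fun ω => orderStat fun i => U i ω)
      (fun ω => points (normalizedSums fun i : Fin (m + 1) => X i ω)) ν μ := by
  have h1 := hasLaw_orderStat hU hunif
  have h2 := hasLaw_expPi hindep hexp (m + 1)
  have hm : Measurable fun x : Fin (m + 1) → ℝ => points (normalizedSums x) :=
    measurable_points.comp measurable_normalizedSums
  refine ⟨h1.aemeasurable, hm.comp_aemeasurable h2.aemeasurable, ?_⟩
  rw [h1.map_eq, ← h2.map_eq, AEMeasurable.map_map_of_aemeasurable hm.aemeasurable h2.aemeasurable]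
  rfl

end Exponential

end UniformSpacings

/-! ### Assembly of the theorem. -/

theorem theorem4p1
    -- for every `m`: independent `U_1, …, U_m`, uniformly distributed on `[0, 1)`
    {Ω : ℕ → Type*} [∀ m, MeasurableSpace (Ω m)]
    (ν : ∀ m, Measure (Ω m)) [∀ m, IsProbabilityMeasure (ν m)]
    (U : ∀ m, Fin m → Ω m → ℝ)
    (hU_indep : ∀ m, iIndepFun (U m) (ν m))
    (hU_unif : ∀ m i, pdf.IsUniform (U m i) (Set.Ico 0 1) (ν m) volume)
    -- independent exponential random variables with mean `1` (`X j` is `X_{j+1}`)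
    {Ω' : Type*} [MeasurableSpace Ω'] (μ : Measure Ω') [IsProbabilityMeasure μ]
    (X : ℕ → Ω' → ℝ)
    (hX_indep : iIndepFun X μ)
    (hX_exp : ∀ j, HasLaw (X j) (expMeasure 1) μ) :
    let J : Ω' → ℝ := fun ω => limitSum fun j => X j ω
    let P : ℝ → ℝ := distFun μ J
    -- the limiting series converges almost surely
    (∀ᵐ ω ∂μ, Summable fun j => coeff j * X j ω) ∧
    -- convergence in distribution
    TendstoInDistribution
      (fun (m : ℕ) (ω : Ω m) => ((m : ℝ) + 1) * weightedSpacings fun i => U m i ω) atTop J ν μ ∧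
    -- pointwise convergence of the distribution functions
    (∀ t : ℝ, Tendsto
      (fun m : ℕ => distFun (ν m)
        (fun ω => ((m : ℝ) + 1) * weightedSpacings fun i => U m i ω) t)
      atTop (𝓝 (P t))) ∧
    (∀ t : ℝ, Tendsto
      (fun m : ℕ => distFun (ν m) (fun ω => maxGain fun i => U m i ω) (t / ((m : ℝ) + 1)))
      atTop (𝓝 (P t))) ∧
    -- the explicit series for the limiting distribution function
    (∀ t : ℝ, 0 ≤ t →
      Summable (fun j : ℕ => (-1 : ℝ) ^ j * 2 ^ (j + 1)
        * Real.exp (-((2 : ℝ) ^ (j + 1) - 1) * t)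
        * ∏ l ∈ Finset.Icc 1 (j + 1), 1 / ((2 : ℝ) ^ l - 1)) ∧
      P t = 1 - ∑' j : ℕ, (-1 : ℝ) ^ j * 2 ^ (j + 1)
        * Real.exp (-((2 : ℝ) ^ (j + 1) - 1) * t)
        * ∏ l ∈ Finset.Icc 1 (j + 1), 1 / ((2 : ℝ) ^ l - 1)) ∧
    -- the integral equation
    (∀ t : ℝ, Real.exp (-t) * P t = ∫ u in t..(2 * t), Real.exp (-u) * P u) := by
  intro J P
  have hae := ae_pos_and_tendsto hX_indep hX_exp
  have hc : Continuous P := continuous_distFun_limitSum hX_indep hX_exp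
  have heq : ∀ t, Real.exp (-t) * P t = ∫ u in t..(2 * t), Real.exp (-u) * P u :=
    distFun_limitSum_integral_equation hX_indep hX_exp
  have hid := fun m => identDistrib_orderStat (hU_indep m) (hU_unif m) hX_indep hX_exp
  have hW : TendstoInDistribution
      (fun (m : ℕ) (ω : Ω m) => ((m : ℝ) + 1) * weightedSpacings fun i => U m i ω)
      atTop J ν μ := by
    refine tendstoInDistribution_of_identDistrib_ae
      (fun m => (hid m).comp (measurable_weightedIncrements m)) ?_
    filter_upwards [hae] with ω hω
    -- On the exponential copy the statistic is (m+1)/S_{m+1} times the partial sum of J with m + 1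
    -- terms.
    have hs := (summable_coeff_mul hω.1 hω.2).hasSum.tendsto_sum_nat
    have h := (tendsto_succ_div_sum hω.2).mul (hs.comp (tendsto_add_atTop_nat 1))
    rw [one_mul] at h
    refine h.congr fun m => ?_
    exact (weightedIncrements_points m (Finset.sum_pos (fun i _ => hω.1 i) (by simp)).ne').symm
  have hM : TendstoInDistribution
      (fun (m : ℕ) (ω : Ω m) => ((m : ℝ) + 1) * maxGain fun i => U m i ω)
      atTop (fun ω => supGain fun j => X j ω) ν μ := by
    refine tendstoInDistribution_of_identDistrib_ae
      (fun m => (hid m).comp (measurable_maxIncrementGain m)) ?_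
    filter_upwards [hae] with ω hω
    have h := (tendsto_succ_div_sum hω.2).mul (tendsto_sup'_fin (bddAbove_gains hω.2))
    rw [one_mul] at h
    refine h.congr fun m => ?_
    exact (maxIncrementGain_points m (Finset.sum_pos (fun i _ => hω.1 i) (by simp))).symm
  have hPM : distFun μ (fun ω => supGain fun j => X j ω) = P := distFun_supGain hX_indep hX_exp
  refine ⟨?_, hW, fun t => tendsto_distFun_of_tendstoInDistribution hW hc t, fun t => ?_,
    fun t ht => ?_, heq⟩
  · filter_upwards [hae] with ω hω using summable_coeff_mul hω.1 hω.2
  · have h := tendsto_distFun_of_tendstoInDistribution hM (hPM ▸ hc) t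
    rw [hPM] at h
    refine h.congr fun m => ?_
    have hm : (0 : ℝ) < (m : ℝ) + 1 := by positivity
    simp only [distFun, le_div_iff₀' hm]
  · have hterm : (fun j : ℕ => (-1 : ℝ) ^ j * 2 ^ (j + 1)
        * Real.exp (-((2 : ℝ) ^ (j + 1) - 1) * t)
        * ∏ l ∈ Finset.Icc 1 (j + 1), 1 / ((2 : ℝ) ^ l - 1)) =
        fun j => seriesCoeff j * Real.exp (-rate (j + 1) * t) := by
      ext j
      rw [seriesCoeff, rate]
      ring
    rw [hterm]
    refine ⟨summable_seriesCoeff_mul_exp ht, ?_⟩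
    refine eq_seriesCdf_of_integral_equation (monotone_distFun _).measurable (distFun_nonneg _)
      (distFun_le_one _) ?_ (fun s _ => heq s) ht
    have := Measure.isProbabilityMeasure_map hW.aemeasurable_limit
    simp only [distFun_eq_cdf hW.aemeasurable_limit]
    exact tendsto_cdf_atTop _
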